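/- All Hilbert spaces are complex, inner products are linear in the first argument, $\mathcal H^*$ denotes the anti-dual of a Hilbert space $\mathcal H$ (bounded conjugate-linear functionals), and $\mathcal R_{\mathcal H}:\mathcal H\to\mathcal H^*$, $\langle \mathcal R_{\mathcal H}g,x\rangle=\langle g,x\rangle_{\mathcal H}$, is the Riesz isomorphism. **Setting.** Let $A:\mathcal X\supset\operatorname{dom}A\to\mathcal Y$ and $B:\mathcal Y\supset\operatorname{dom}B\to\mathcal X$ be closed, densely defined linear operators between Hilbert spaces such that $S=A^*A$ is uniformly positive (there is $c>0$ with $\langle Sx,x\rangle\ge c\|x\|^2$ on $\operatorname{dom}S$) and $A^*\subset -B$. Let $\mathcal X_h=\operatorname{dom}A$ with inner product $\langle Ax,Ay\rangle_{\mathcal Y}$, let $\mathcal Z_h=\mathcal X_h\times\mathcal X$, and let $\mathcal A$ be the operator in $\mathcal Z_h$ given by $$\operatorname{dom}\mathcal A=\{(z_1,z_2)\in\mathcal X_h\times\mathcal X_h: Az_1\in\operatorname{dom}B\},\qquad \mathcal A(z_1,z_2)=(z_2,BAz_1).$$ Put $\mathcal A_0=\mathcal A^*$. Let $\mathcal G_1,\mathcal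 G_2$ be Hilbert spaces and $\Lambda=(\Lambda_1,\Lambda_2):\operatorname{dom}A\to\mathcal G_1\times\mathcal G_2^*$, $\Pi=(\Pi_1,\Pi_2):\operatorname{dom}B\to\mathcal G_1^*\times\mathcal G_2$ a boundary triplet for the dual pair $(A^*,-B^*)$, i.e. $\Lambda,\Pi$ are linear and surjective and $$-\langle By,x\rangle_{\mathcal X}-\langle y,Ax\rangle_{\mathcal Y}=\langle\Pi_1y,\Lambda_1x\rangle_{\mathcal G_1^*,\mathcal G_1}-\langle\Pi_2y,\Lambda_2x\rangle_{\mathcal G_2,\mathcal G_2^*}\qquad(x\in\operatorname{dom}A,\ y\in\operatorname{dom}B).$$ Put $\mathcal G=\mathcal G_1\times\mathcal G_2$ and, for $z\in\operatorname{dom}\mathcal A$, $\Gamma_0z=(\Lambda_1z_2,\Pi_2Az_1)\in\mathcal G$ and $\Gamma_1z=(-\Pi_1Az_1,\Lambda_2z_2)\in\mathcal G^*=\mathcal G_1^*\times\mathcal G_2^*$. **Nodes.** A colligation $\Theta=(G,L,K)$ on Hilbert spaces $(\mathcal U,\mathcal Z,\mathcal W)$ consists of linear maps $G,L,K$ with a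 common domain in $\mathcal Z$ and with values in $\mathcal U,\mathcal Z,\mathcal W$. It is a boundary node if the combined operator $(G,L,K)$ is closed, $G$ is surjective, $\ker G$ is dense in $\mathcal Z$ and $L|_{\ker G}$ has non-empty resolvent set; it is internally well-posed if moreover $L|_{\ker G}$ generates a strongly continuous semigroup. It is scattering passive if it is an internally well-posed boundary node and all smooth solutions on $[0,\infty)$ of $u=Gz$, $\dot z=Lz$, $y=Kz$ (that is, $u\in C^2$, $z\in C^1$ in $\mathcal Z$, and $z$ continuous in $\operatorname{dom}\Theta$ for the graph norm of $(G,L,K)$) satisfy $\frac{d}{dt}\|z(t)\|^2+\|y(t)\|^2\le\|u(t)\|^2$; it is scattering energy-preserving if equality holds. For $\mathcal W=\mathcal U$ and $\operatorname{Re}\beta>0$ the external Cayley transform is $\Theta^{(\beta)}=\big(\tfrac{1}{\sqrt{2\operatorname{Re}\beta}}(\beta G+K),\,L,\,\tfrac1{\sqrt{2\operatorname{Re}\beta}}(\overline\beta G-K)\big)$ with the same domain. $\Theta$ is impedance passive (impedance energy-preserving) if $\Theta^{(\beta)}$ is a scattering passive (scattering energy-preserving) boundary node for some $\beta$ with $\operatorname{Re}\beta>0$.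 **Statement.** One has $\mathcal A_0^*=\mathcal A$. Let $P\in L(\mathcal G^*)$ and let $N$ be the colligation on $(\mathcal G^*,\mathcal Z_h,\mathcal G^*)$ with domain $\operatorname{dom}\mathcal A_0^*$ and $$N=\Big(\tfrac1{\sqrt2}(\mathcal R_{\mathcal G}\Gamma_0+\Gamma_1),\ \mathcal A_0^*,\ -\tfrac1{\sqrt2}P(\mathcal R_{\mathcal G}\Gamma_0-\Gamma_1)\Big).$$ Then its external Cayley transform with parameter $\beta=1$ is $$N^{(1)}=\Big(\tfrac12\big((1-P)\mathcal R_{\mathcal G}\Gamma_0+(1+P)\Gamma_1\big),\ \mathcal A_0^*,\ \tfrac12\big((1+P)\mathcal R_{\mathcal G}\Gamma_0+(1-P)\Gamma_1\big)\Big).$$ If $\|P\|\le1$, then $N^{(1)}$ is an internally well-posed boundary node and it is impedance passive. If $P$ is unitary, then $N^{(1)}$ is impedance energy-preserving. -/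

import Mathlib

open Set Filter Topology
open scoped NNReal ComplexConjugate LinearPMap

noncomputable section

/-! ### Anti-duals of complex Hilbert spaces -/

/-- The anti-dual of a complex Hilbert space: bounded conjugate-linear functionals, with the
operator norm.  The duality pairing `⟨f, x⟩` is `f x`. -/
abbrev AntiDual (H : Type*) [NormedAddCommGroup H] [InnerProductSpace ℂ H] : Type _ :=
  H →L⋆[ℂ] ℂ

/-- The linear Riesz isomorphism `H → H*`, `⟨R g, x⟩ = ⟨g, x⟩_H` (linear in `g`, conjugate-linear
in `x`; Mathlib's `inner` is conjugate-linear in its first argument). -/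
def riesz (H : Type*) [NormedAddCommGroup H] [InnerProductSpace ℂ H] [CompleteSpace H] :
    H ≃ₗᵢ[ℂ] AntiDual H :=
  LinearIsometryEquiv.ofSurjective
    { toLinearMap := (innerSLFlip ℂ : H →L[ℂ] AntiDual H).toLinearMap
      norm_map' := by
        intro g
        apply le_antisymm
        · refine ContinuousLinearMap.opNorm_le_bound _ (norm_nonneg g) (fun x => ?_)
          simpa [mul_comm] using norm_inner_le_norm (𝕜 := ℂ) x g
        · by_cases hg : g = 0
          · simp [hg]
          · have h := ContinuousLinearMap.le_opNorm (innerSLFlip ℂ g : AntiDual H) g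
            have hpos : 0 < ‖g‖ := norm_pos_iff.2 hg
            have h2 : ‖(innerSLFlip ℂ g : AntiDual H) g‖ = ‖g‖ * ‖g‖ := by
              simp [inner_self_eq_norm_sq_to_K, pow_two]
            rw [h2] at h
            exact le_of_mul_le_mul_right h hpos }
    (by
      intro f
      let f' : StrongDual ℂ H :=
        { toFun := fun x => conj (f x)
          map_add' := by intro x y; simp
          map_smul' := by intro c x; simp
          cont := by fun_prop }
      refine ⟨(InnerProductSpace.toDual ℂ H).symm f', ?_⟩
      ext x
      have h : inner ℂ ((InnerProductSpace.toDual ℂ H).symm f') x = f' x :=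
        InnerProductSpace.toDual_symm_apply
      change inner ℂ x ((InnerProductSpace.toDual ℂ H).symm f') = f x
      rw [← inner_conj_symm, h]
      simp [f'])

theorem riesz_apply {H : Type*} [NormedAddCommGroup H] [InnerProductSpace ℂ H] [CompleteSpace H]
    (g x : H) : riesz H g x = inner ℂ x g := rfl

/-- The anti-dual is a Hilbert space for its operator norm; the inner product is transported by
the Riesz isomorphism. -/
instance AntiDual.instInnerProductSpace (H : Type*) [NormedAddCommGroup H]
    [InnerProductSpace ℂ H] [CompleteSpace H] : InnerProductSpace ℂ (AntiDual H) where
  toNormedSpace := inferInstance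
  inner f g := inner ℂ ((riesz H).symm f) ((riesz H).symm g)
  norm_sq_eq_re_inner f := by
    rw [← (riesz H).symm.norm_map f]
    exact norm_sq_eq_re_inner (𝕜 := ℂ) ((riesz H).symm f)
  conj_inner_symm f g := inner_conj_symm _ _
  add_left f g h := by simp
  smul_left f g c := by simp [mul_comm]

/-- The canonical identification of `G₁* × G₂*` with the anti-dual of the product Hilbert space:
`⟨(f₁, f₂), (g₁, g₂)⟩ = ⟨f₁, g₁⟩ + ⟨f₂, g₂⟩`. -/
def antiDualProd (G₁ G₂ : Type*) [NormedAddCommGroup G₁] [InnerProductSpace ℂ G₁]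
    [NormedAddCommGroup G₂] [InnerProductSpace ℂ G₂] :
    (AntiDual G₁ × AntiDual G₂) →ₗ[ℂ] AntiDual (WithLp 2 (G₁ × G₂)) where
  toFun f := f.1.comp (WithLp.fstL 2 ℂ G₁ G₂) + f.2.comp (WithLp.sndL 2 ℂ G₁ G₂)
  map_add' f g := by
    ext x
    simp [add_add_add_comm]
  map_smul' c f := by
    ext x
    simp

/-! ### Semigroups, resolvents, boundary nodes -/

section Nodes

variable {X : Type*} [NormedAddCommGroup X] [InnerProductSpace ℂ X]

/-- A strongly continuous semigroup of bounded operators on `X`. -/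
structure IsC0Semigroup (T : ℝ≥0 → X →L[ℂ] X) : Prop where
  zero : T 0 = 1
  add : ∀ s t, T (s + t) = T s * T t
  cont : ∀ x, Continuous fun t => T t x

/-- `A` generates a strongly continuous semigroup: `x ∈ dom A` and `A x = y` exactly when
`(T(h) x - x) / h → y` as `h → 0+`. -/
def GeneratesC0Semigroup (A : X →ₗ.[ℂ] X) : Prop :=
  ∃ T : ℝ≥0 → X →L[ℂ] X, IsC0Semigroup T ∧
    ∀ x y : X, (x, y) ∈ A.graph ↔
      Tendsto (fun h : ℝ≥0 => ((h : ℂ)⁻¹) • (T h x - x)) (𝓝[>] 0) (𝓝 y)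

/-- The resolvent set: those `μ` for which `μ - A : dom A → X` is bijective with a bounded
inverse `R`. -/
def resolventSetPMap (A : X →ₗ.[ℂ] X) : Set ℂ :=
  {μ | ∃ R : X →L[ℂ] X,
    (∀ x : X, ∃ h : R x ∈ A.domain, μ • R x - A ⟨R x, h⟩ = x) ∧
    ∀ x : A.domain, R (μ • (x : X) - A x) = x}

end Nodes

/-- A colligation on Hilbert spaces `(U, X, Y)`: linear maps `G, L, K` with a common domain in
`X`, with values in `U`, `X`, `Y`. -/
structure Colligation (U X Y : Type*)
    [NormedAddCommGroup U] [InnerProductSpace ℂ U] [CompleteSpace U]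
    [NormedAddCommGroup X] [InnerProductSpace ℂ X] [CompleteSpace X]
    [NormedAddCommGroup Y] [InnerProductSpace ℂ Y] [CompleteSpace Y] where
  /-- the common domain -/
  dom : Submodule ℂ X
  /-- the input boundary operator -/
  G : dom →ₗ[ℂ] U
  /-- the interior operator -/
  L : dom →ₗ[ℂ] X
  /-- the output boundary operator -/
  K : dom →ₗ[ℂ] Y

namespace Colligation

variable {U X Y : Type*}
  [NormedAddCommGroup U] [InnerProductSpace ℂ U] [CompleteSpace U]
  [NormedAddCommGroup X] [InnerProductSpace ℂ X] [CompleteSpace X]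
  [NormedAddCommGroup Y] [InnerProductSpace ℂ Y] [CompleteSpace Y]

/-- The combined operator `[G; L; K] : X ⊃ dom → U × X × Y`. -/
def combined (Θ : Colligation U X Y) : X →ₗ.[ℂ] (U × X × Y) :=
  ⟨Θ.dom, Θ.G.prod (Θ.L.prod Θ.K)⟩

/-- The main operator: the restriction of `L` to `ker G`. -/
def mainOp (Θ : Colligation U X Y) : X →ₗ.[ℂ] X :=
  (⟨Θ.dom, Θ.L⟩ : X →ₗ.[ℂ] X).domRestrict ((LinearMap.ker Θ.G).map Θ.dom.subtype)

/-- Boundary nodes. -/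
structure IsBoundaryNode (Θ : Colligation U X Y) : Prop where
  closed : Θ.combined.IsClosed
  surjective : Function.Surjective Θ.G
  dense_ker : Dense (((LinearMap.ker Θ.G).map Θ.dom.subtype : Submodule ℂ X) : Set X)
  resolvent : (resolventSetPMap Θ.mainOp).Nonempty

/-- Internally well-posed boundary nodes (in the forward time direction). -/
structure IsInternallyWellPosed (Θ : Colligation U X Y) : Prop extends Θ.IsBoundaryNode where
  generates : GeneratesC0Semigroup Θ.mainOp

/-- Smooth solutions on `[0, ∞)` of `u = G z`, `z' = L z`, `y = K z`: the input `u` is `C²`, the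
state `z` is `C¹` in `X` and continuous in `dom Θ` with the graph norm of `[G; L; K]` (that is,
`z`, `G z`, `L z` and `K z` are continuous).  The values of the functions at negative times are
irrelevant. -/
structure IsSmoothSolution (Θ : Colligation U X Y) (u : ℝ → U) (z : ℝ → Θ.dom) (y : ℝ → Y) :
    Prop where
  input_smooth : ContDiffOn ℝ 2 u (Ici 0)
  state_smooth : ContDiffOn ℝ 1 (fun t => (z t : X)) (Ici 0)
  cont_G : ContinuousOn (fun t => Θ.G (z t)) (Ici 0)
  cont_L : ContinuousOn (fun t => Θ.L (z t)) (Ici 0)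
  cont_K : ContinuousOn (fun t => Θ.K (z t)) (Ici 0)
  input_eq : ∀ t ∈ Ici (0 : ℝ), u t = Θ.G (z t)
  state_eq : ∀ t ∈ Ici (0 : ℝ), HasDerivWithinAt (fun s => (z s : X)) (Θ.L (z t)) (Ici 0) t
  output_eq : ∀ t ∈ Ici (0 : ℝ), y t = Θ.K (z t)

/-- Scattering passive boundary nodes: internally well-posed, and every smooth solution satisfies
`d/dt ‖z‖² + ‖y‖² ≤ ‖u‖²`.  (The derivative exists because `z` is `C¹`; at `t = 0` it is the
right derivative.) -/
def IsScatteringPassive (Θ : Colligation U X Y) : Prop :=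
  Θ.IsInternallyWellPosed ∧
    ∀ (u : ℝ → U) (z : ℝ → Θ.dom) (y : ℝ → Y), Θ.IsSmoothSolution u z y →
      ∀ t ∈ Ici (0 : ℝ),
        derivWithin (fun s => ‖(z s : X)‖ ^ 2) (Ici 0) t + ‖y t‖ ^ 2 ≤ ‖u t‖ ^ 2

/-- Scattering energy-preserving boundary nodes: equality in the energy balance. -/
def IsScatteringEnergyPreserving (Θ : Colligation U X Y) : Prop :=
  Θ.IsInternallyWellPosed ∧
    ∀ (u : ℝ → U) (z : ℝ → Θ.dom) (y : ℝ → Y), Θ.IsSmoothSolution u z y →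
      ∀ t ∈ Ici (0 : ℝ),
        derivWithin (fun s => ‖(z s : X)‖ ^ 2) (Ici 0) t + ‖y t‖ ^ 2 = ‖u t‖ ^ 2

/-- The external Cayley transform with parameter `β` (used for `0 < Re β`). -/
def cayley (β : ℂ) (Θ : Colligation U X U) : Colligation U X U where
  dom := Θ.dom
  G := ((Real.sqrt (2 * β.re) : ℂ)⁻¹) • (β • Θ.G + Θ.K)
  L := Θ.L
  K := ((Real.sqrt (2 * β.re) : ℂ)⁻¹) • (conj β • Θ.G - Θ.K)

/-- Impedance passive colligations. -/
def IsImpedancePassive (Θ : Colligation U X U) : Prop :=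
  ∃ β : ℂ, 0 < β.re ∧ (Θ.cayley β).IsScatteringPassive

/-- Impedance energy-preserving colligations. -/
def IsImpedanceEnergyPreserving (Θ : Colligation U X U) : Prop :=
  ∃ β : ℂ, 0 < β.re ∧ (Θ.cayley β).IsScatteringEnergyPreserving

end Colligation

/-! ### Abstract second order systems -/

/-- The operator `S = A* A`, with `dom S = {x ∈ dom A | A x ∈ dom A*}`. -/
def stiffness {X Y : Type*} [NormedAddCommGroup X] [InnerProductSpace ℂ X] [CompleteSpace X]
    [NormedAddCommGroup Y] [InnerProductSpace ℂ Y] (A : X →ₗ.[ℂ] Y) : X →ₗ.[ℂ] X where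
  domain := (A†.domain.comap A.toFun).map A.domain.subtype
  toFun :=
    A†.toFun.comp
      ((A.toFun.comp (Submodule.inclusion (Submodule.map_subtype_le A.domain _))).codRestrict
        A†.domain (by
          rintro ⟨_, x, hx, rfl⟩
          exact hx))

/-- Uniform positivity (coercivity) of an operator. -/
def IsUniformlyPositive {X : Type*} [NormedAddCommGroup X] [InnerProductSpace ℂ X]
    (P : X →ₗ.[ℂ] X) : Prop :=
  ∃ c : ℝ, 0 < c ∧ ∀ x : P.domain, c * ‖(x : X)‖ ^ 2 ≤ (inner ℂ (x : X) (P x)).re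

/-- The operators of a second order system with boundary: `A : X ⊃ dom A → Y` and
`B : Y ⊃ dom B → X` are closed and densely defined, `S = A* A` is uniformly positive, and
`A* ⊂ -B`, i.e. `(A*, -B*)` is a dual pair. -/
structure SecondOrderSystem (X Y : Type*)
    [NormedAddCommGroup X] [InnerProductSpace ℂ X] [CompleteSpace X]
    [NormedAddCommGroup Y] [InnerProductSpace ℂ Y] [CompleteSpace Y] where
  A : X →ₗ.[ℂ] Y
  B : Y →ₗ.[ℂ] X
  A_closed : A.IsClosed
  A_dense : Dense (A.domain : Set X)
  B_closed : B.IsClosed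
  B_dense : Dense (B.domain : Set Y)
  stiffness_pos : IsUniformlyPositive (stiffness A)
  adjoint_le : A† ≤ -B

namespace SecondOrderSystem

variable {X Y : Type*}
  [NormedAddCommGroup X] [InnerProductSpace ℂ X] [CompleteSpace X]
  [NormedAddCommGroup Y] [InnerProductSpace ℂ Y] [CompleteSpace Y]

theorem exists_coercive (S : SecondOrderSystem X Y) :
    ∃ c : ℝ, 0 < c ∧ ∀ x : S.A.domain, ∀ w : X,
      (∀ v : S.A.domain, inner ℂ w (v : X) = inner ℂ (S.A x) (S.A v)) →
        c * ‖(x : X)‖ ^ 2 ≤ ‖S.A x‖ ^ 2 := by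
  obtain ⟨c, hc, h⟩ := S.stiffness_pos
  refine ⟨c, hc, fun x w hw => ?_⟩
  have hx : S.A x ∈ (S.A)†.domain := LinearPMap.mem_adjoint_domain_of_exists _ ⟨w, hw⟩
  have hxS : (x : X) ∈ (stiffness S.A).domain := ⟨x, hx, rfl⟩
  have h1 := h ⟨x, hxS⟩
  have h2 : (stiffness S.A) ⟨x, hxS⟩ = (S.A)† ⟨S.A x, hx⟩ := rfl
  have h3 := LinearPMap.adjoint_isFormalAdjoint S.A_dense ⟨S.A x, hx⟩ x
  rw [h2, ← inner_conj_symm, Complex.conj_re, h3] at h1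
  refine h1.trans (le_of_eq ?_)
  exact inner_self_eq_norm_sq (𝕜 := ℂ) (S.A x)

/-- Coercivity of `S = A* A` passes to `A`. -/
theorem A_bounded_below (S : SecondOrderSystem X Y) :
    ∃ c : ℝ, 0 < c ∧ ∀ x : S.A.domain, c * ‖(x : X)‖ ^ 2 ≤ ‖S.A x‖ ^ 2 := by
  obtain ⟨c, hc, h⟩ := S.exists_coercive
  refine ⟨c, hc, ?_⟩
  let e := (WithLp.linearEquiv 2 ℂ (X × Y))
  let K : Submodule ℂ (WithLp 2 (X × Y)) := S.A.graph.comap e.toLinearMap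
  have hKc : IsClosed (K : Set (WithLp 2 (X × Y))) :=
    IsClosed.preimage (WithLp.prod_continuous_ofLp 2 X Y) S.A_closed
  have : CompleteSpace K := hKc.completeSpace_coe
  have hmem : ∀ v : S.A.domain, (WithLp.toLp 2 ((v : X), S.A v) : WithLp 2 (X × Y)) ∈ K :=
    fun v => LinearPMap.mem_graph S.A v
  let D : Submodule ℂ K :=
    { carrier := {p | ∃ w : X, ∀ v : S.A.domain,
        inner ℂ w (v : X) = inner ℂ (p : WithLp 2 (X × Y)).snd (S.A v)}
      add_mem' := by
        rintro a b ⟨w, hw⟩ ⟨w', hw'⟩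
        exact ⟨w + w', fun v => by simp [hw, hw']⟩
      zero_mem' := ⟨0, fun v => by simp⟩
      smul_mem' := by
        rintro r a ⟨w, hw⟩
        exact ⟨r • w, fun v => by simp [hw]⟩ }
  have hD : Dense (D : Set K) := by
    rw [Submodule.dense_iff_topologicalClosure_eq_top, Submodule.topologicalClosure_eq_top_iff,
      Submodule.eq_bot_iff]
    intro q hq
    obtain ⟨v, hv1, hv2⟩ := (LinearPMap.mem_graph_iff S.A).1 q.2
    have key : ∀ g : X, inner ℂ g (v : X) = 0 := by
      intro g
      let p := K.orthogonalProjectionOnto (WithLp.toLp 2 (g, (0 : Y)))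
      have horth : ∀ k ∈ K,
          inner ℂ ((WithLp.toLp 2 (g, (0 : Y)) : WithLp 2 (X × Y)) - p) k = 0 :=
        fun k hk => Submodule.starProjection_inner_eq_zero _ k hk
      have hw : ∀ u : S.A.domain, inner ℂ (g - (p : WithLp 2 (X × Y)).fst) (u : X)
          = inner ℂ (p : WithLp 2 (X × Y)).snd (S.A u) := by
        intro u
        have := horth _ (hmem u)
        simp only [WithLp.prod_inner_apply, WithLp.ofLp_sub, Prod.fst_sub, Prod.snd_sub,
          zero_sub, inner_neg_left] at this
        exact sub_eq_zero.1 ((sub_eq_add_neg _ _).trans this)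
      have hpD : p ∈ D := ⟨_, hw⟩
      have h0 := Submodule.inner_right_of_mem_orthogonal hpD hq
      have h1 : inner ℂ (p : WithLp 2 (X × Y)) (q : WithLp 2 (X × Y)) = 0 := h0
      rw [WithLp.prod_inner_apply] at h1
      have hq1 : (q : WithLp 2 (X × Y)).ofLp.fst = (v : X) := hv1.symm
      have hq2 : (q : WithLp 2 (X × Y)).ofLp.snd = S.A v := hv2.symm
      rw [hq1, hq2] at h1
      have h2 := hw v
      rw [inner_sub_left, sub_eq_iff_eq_add] at h2
      rw [h2, add_comm]
      exact h1
    have hv0 : (v : X) = 0 := inner_self_eq_zero.1 (key v)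
    have hv0' : v = 0 := Subtype.ext hv0
    apply Subtype.ext
    apply (WithLp.linearEquiv 2 ℂ (X × Y)).injective
    refine Prod.ext ?_ ?_
    · exact hv1.symm.trans hv0
    · refine hv2.symm.trans ?_
      rw [hv0']
      exact S.A.map_zero
  have hclosed : IsClosed {p : K | c * ‖(p : WithLp 2 (X × Y)).fst‖ ^ 2
      ≤ ‖(p : WithLp 2 (X × Y)).snd‖ ^ 2} := by
    apply isClosed_le
    · have : Continuous fun p : K => (p : WithLp 2 (X × Y)).fst :=
        (WithLp.fstL 2 ℂ X Y).continuous.comp continuous_subtype_val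
      fun_prop
    · have : Continuous fun p : K => (p : WithLp 2 (X × Y)).snd :=
        (WithLp.sndL 2 ℂ X Y).continuous.comp continuous_subtype_val
      fun_prop
  have hsub : (D : Set K) ⊆ {p : K | c * ‖(p : WithLp 2 (X × Y)).fst‖ ^ 2
      ≤ ‖(p : WithLp 2 (X × Y)).snd‖ ^ 2} := by
    rintro p ⟨w, hw⟩
    obtain ⟨v, hv1, hv2⟩ := (LinearPMap.mem_graph_iff S.A).1 p.2
    have hp1 : (p : WithLp 2 (X × Y)).fst = (v : X) := hv1.symm
    have hp2 : (p : WithLp 2 (X × Y)).snd = S.A v := hv2.symm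
    simp only [Set.mem_ofPred_eq, hp1, hp2]
    rw [hp2] at hw
    exact h v w hw
  intro x
  have := hclosed.closure_subset_iff.2 hsub (hD ⟨_, hmem x⟩)
  exact this

theorem A_injective (S : SecondOrderSystem X Y) : Function.Injective S.A.toFun := by
  obtain ⟨c, hc, h⟩ := S.A_bounded_below
  rw [← LinearMap.ker_eq_bot, LinearMap.ker_eq_bot']
  intro x hx
  have hx' : S.A x = 0 := hx
  have h1 := h x
  rw [hx', norm_zero, zero_pow two_ne_zero] at h1
  have h2 : ‖(x : X)‖ ^ 2 ≤ 0 := by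
    by_contra hcon
    push Not at hcon
    have := mul_pos hc hcon
    linarith
  have h3 : ‖(x : X)‖ = 0 := pow_eq_zero_iff two_ne_zero |>.1 (le_antisymm h2 (sq_nonneg _))
  exact Subtype.ext (norm_eq_zero.1 h3)

/-- The energetic space `X_h`: the vector space `dom A` with the inner product
`h(x, y) = ⟨A x, A y⟩`. -/
def EnergySpace (S : SecondOrderSystem X Y) : Type _ := S.A.domain

instance (S : SecondOrderSystem X Y) : AddCommGroup S.EnergySpace :=
  inferInstanceAs (AddCommGroup S.A.domain)

instance (S : SecondOrderSystem X Y) : Module ℂ S.EnergySpace :=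
  inferInstanceAs (Module ℂ S.A.domain)

/-- An element of `X_h` as an element of `dom A ⊂ X`. -/
def toDom (S : SecondOrderSystem X Y) : S.EnergySpace ≃ₗ[ℂ] S.A.domain :=
  LinearEquiv.refl ℂ S.A.domain

/-- `A` as a linear map on `X_h`. -/
def AE (S : SecondOrderSystem X Y) : S.EnergySpace →ₗ[ℂ] Y :=
  S.A.toFun.comp S.toDom.toLinearMap

instance (S : SecondOrderSystem X Y) : NormedAddCommGroup S.EnergySpace :=
  NormedAddCommGroup.induced S.EnergySpace Y S.AE S.A_injective

instance (S : SecondOrderSystem X Y) : InnerProductSpace ℂ S.EnergySpace where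
  toNormedSpace := NormedSpace.induced ℂ S.EnergySpace Y S.AE
  inner x y := inner ℂ (S.AE x) (S.AE y)
  norm_sq_eq_re_inner x := norm_sq_eq_re_inner (𝕜 := ℂ) (S.AE x)
  conj_inner_symm x y := inner_conj_symm _ _
  add_left x y z := by simp
  smul_left x y r := by simp [mul_comm]

/-- `A : X_h → Y` is isometric. -/
theorem AE_isometry (S : SecondOrderSystem X Y) : Isometry S.AE :=
  AddMonoidHomClass.isometry_of_norm S.AE (fun _ => rfl)

instance (S : SecondOrderSystem X Y) : CompleteSpace S.EnergySpace := by
  rw [completeSpace_iff_isComplete_range S.AE_isometry.isUniformInducing]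
  apply IsClosed.isComplete
  apply isClosed_of_closure_subset
  intro y hy
  obtain ⟨s, hs, hlim⟩ := mem_closure_iff_seq_limit.1 hy
  choose x hx using hs
  obtain ⟨c, hc, h⟩ := S.A_bounded_below
  have hb : ∀ v : S.A.domain, ‖(v : X)‖ ≤ Real.sqrt (1 / c) * ‖S.A v‖ := by
    intro v
    rw [← Real.sqrt_sq (norm_nonneg (v : X)), ← Real.sqrt_sq (norm_nonneg (S.A v)),
      ← Real.sqrt_mul (by positivity)]
    apply Real.sqrt_le_sqrt
    rw [one_div, inv_mul_eq_div, le_div_iff₀ hc, mul_comm]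
    exact h v
  have hcs : CauchySeq fun n => S.A (S.toDom (x n)) := by
    have : (fun n => S.A (S.toDom (x n))) = s := funext hx
    rw [this]
    exact hlim.cauchySeq
  have hcx : CauchySeq fun n => ((S.toDom (x n) : S.A.domain) : X) := by
    rw [Metric.cauchySeq_iff] at hcs ⊢
    intro ε hε
    obtain ⟨N, hN⟩ := hcs (ε / (Real.sqrt (1 / c) + 1)) (by positivity)
    refine ⟨N, fun m hm n hn => ?_⟩
    have h1 := hb (S.toDom (x m) - S.toDom (x n))
    have h2 := hN m hm n hn
    rw [dist_eq_norm] at h2 ⊢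
    rw [LinearPMap.map_sub] at h1
    rw [lt_div_iff₀ (by positivity)] at h2
    refine lt_of_le_of_lt h1 (lt_of_le_of_lt ?_ h2)
    rw [mul_comm]
    gcongr
    linarith
  obtain ⟨x₀, hx₀⟩ := cauchySeq_tendsto_of_complete hcx
  have hs' : Tendsto (fun n => S.A (S.toDom (x n))) atTop (𝓝 y) := by
    have : (fun n => S.A (S.toDom (x n))) = s := funext hx
    rw [this]
    exact hlim
  have hg : (x₀, y) ∈ S.A.graph :=
    S.A_closed.mem_of_tendsto (hx₀.prodMk_nhds hs')
      (Eventually.of_forall fun n => LinearPMap.mem_graph S.A _)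
  obtain ⟨v, _, hv2⟩ := (LinearPMap.mem_graph_iff S.A).1 hg
  exact ⟨S.toDom.symm v, hv2⟩

/-- The state space `Z_h = X_h × X` with the product Hilbert space norm. -/
abbrev StateSpace (S : SecondOrderSystem X Y) : Type _ := WithLp 2 (S.EnergySpace × X)

/-- `dom 𝒜 = {(z₁, z₂) ∈ X_h × X_h | A z₁ ∈ dom B}` (recall `X_h = dom A` as a set). -/
def stateDom (S : SecondOrderSystem X Y) : Submodule ℂ S.StateSpace where
  carrier := {z | S.AE z.fst ∈ S.B.domain ∧ z.snd ∈ S.A.domain}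
  add_mem' := by
    rintro a b ⟨h1, h2⟩ ⟨h3, h4⟩
    refine ⟨?_, ?_⟩
    · rw [WithLp.add_fst, map_add]
      exact add_mem h1 h3
    · rw [WithLp.add_snd]
      exact add_mem h2 h4
  zero_mem' := by
    refine ⟨?_, ?_⟩
    · rw [WithLp.zero_fst, map_zero]
      exact zero_mem _
    · rw [WithLp.zero_snd]
      exact zero_mem _
  smul_mem' := by
    rintro r a ⟨h1, h2⟩
    refine ⟨?_, ?_⟩
    · rw [WithLp.smul_fst, map_smul]
      exact Submodule.smul_mem _ _ h1
    · rw [WithLp.smul_snd]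
      exact Submodule.smul_mem _ _ h2

/-- `z ↦ A z₁`, as a map from `dom 𝒜` to `dom B`. -/
def strain (S : SecondOrderSystem X Y) : S.stateDom →ₗ[ℂ] S.B.domain :=
  ((S.AE.comp (WithLp.fstL 2 ℂ S.EnergySpace X).toLinearMap).comp
    S.stateDom.subtype).codRestrict S.B.domain (fun z => z.2.1)

/-- `z ↦ z₂`, as a map from `dom 𝒜` to `dom A`. -/
def velocity (S : SecondOrderSystem X Y) : S.stateDom →ₗ[ℂ] S.A.domain :=
  ((WithLp.sndL 2 ℂ S.EnergySpace X).toLinearMap.comp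
    S.stateDom.subtype).codRestrict S.A.domain (fun z => z.2.2)

/-- The operator `𝒜 = [0, I; B A, 0]`, `𝒜 (z₁, z₂) = (z₂, B A z₁)`, in `Z_h`. -/
def stateOp (S : SecondOrderSystem X Y) : S.StateSpace →ₗ.[ℂ] S.StateSpace where
  domain := S.stateDom
  toFun := (WithLp.linearEquiv 2 ℂ (S.EnergySpace × X)).symm.toLinearMap.comp
    ((S.toDom.symm.toLinearMap.comp S.velocity).prod (S.B.toFun.comp S.strain))

variable {G₁ G₂ : Type*}
  [NormedAddCommGroup G₁] [InnerProductSpace ℂ G₁] [CompleteSpace G₁]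
  [NormedAddCommGroup G₂] [InnerProductSpace ℂ G₂] [CompleteSpace G₂]

/-- A boundary triplet `(G₁ × G₂, Λ, Π)` for the dual pair `(A*, -B*)`: linear surjections
`Λ : dom A → G₁ × G₂*` and `Π : dom B → G₁* × G₂` with the Green identity
`-⟨B y, x⟩ - ⟨y, A x⟩ = ⟨Π₁ y, Λ₁ x⟩ - ⟨Π₂ y, Λ₂ x⟩`.
(The scalar product `⟨a, b⟩`, linear in `a`, is `inner ℂ b a`; the pairing of `g ∈ G₂` with
`f ∈ G₂*` is the conjugate of `f g`.) -/
structure DualPairTriplet (S : SecondOrderSystem X Y) (G₁ G₂ : Type*)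
    [NormedAddCommGroup G₁] [InnerProductSpace ℂ G₁] [CompleteSpace G₁]
    [NormedAddCommGroup G₂] [InnerProductSpace ℂ G₂] [CompleteSpace G₂] where
  Lam₁ : S.A.domain →ₗ[ℂ] G₁
  Lam₂ : S.A.domain →ₗ[ℂ] AntiDual G₂
  Pi₁ : S.B.domain →ₗ[ℂ] AntiDual G₁
  Pi₂ : S.B.domain →ₗ[ℂ] G₂
  Lam_surjective : Function.Surjective (Lam₁.prod Lam₂)
  Pi_surjective : Function.Surjective (Pi₁.prod Pi₂)
  green : ∀ (y : S.B.domain) (x : S.A.domain),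
    -inner ℂ (x : X) (S.B y) - inner ℂ (S.A x) (y : Y)
      = Pi₁ y (Lam₁ x) - conj (Lam₂ x (Pi₂ y))

namespace DualPairTriplet

variable {S : SecondOrderSystem X Y}

/-- `Γ₀ z = (Λ₁ z₂, Π₂ A z₁) ∈ 𝒢 = G₁ × G₂`. -/
def Γ₀ (T : S.DualPairTriplet G₁ G₂) : S.stateDom →ₗ[ℂ] WithLp 2 (G₁ × G₂) :=
  (WithLp.linearEquiv 2 ℂ (G₁ × G₂)).symm.toLinearMap.comp
    ((T.Lam₁.comp S.velocity).prod (T.Pi₂.comp S.strain))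

/-- `Γ₁ z = (-Π₁ A z₁, Λ₂ z₂) ∈ 𝒢* = G₁* × G₂*`. -/
def Γ₁ (T : S.DualPairTriplet G₁ G₂) : S.stateDom →ₗ[ℂ] AntiDual (WithLp 2 (G₁ × G₂)) :=
  (antiDualProd G₁ G₂).comp
    ((-(T.Pi₁.comp S.strain)).prod (T.Lam₂.comp S.velocity))

/-- `R_𝒢 Γ₀ : dom 𝒜 → 𝒢*`. -/
def RΓ₀ (T : S.DualPairTriplet G₁ G₂) : S.stateDom →ₗ[ℂ] AntiDual (WithLp 2 (G₁ × G₂)) :=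
  (riesz (WithLp 2 (G₁ × G₂))).toLinearEquiv.toLinearMap.comp T.Γ₀

/-- The node with input `(R Γ₀ + Γ₁) / √2`, interior operator `𝒜` and output
`-P (R Γ₀ - Γ₁) / √2`. -/
def scatteringNode (T : S.DualPairTriplet G₁ G₂)
    (P : AntiDual (WithLp 2 (G₁ × G₂)) →L[ℂ] AntiDual (WithLp 2 (G₁ × G₂))) :
    Colligation (AntiDual (WithLp 2 (G₁ × G₂))) S.StateSpace
      (AntiDual (WithLp 2 (G₁ × G₂))) where
  dom := S.stateDom
  G := ((Real.sqrt 2 : ℂ)⁻¹) • (T.RΓ₀ + T.Γ₁)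
  L := S.stateOp.toFun
  K := (-(Real.sqrt 2 : ℂ)⁻¹) • (P.toLinearMap.comp (T.RΓ₀ - T.Γ₁))

/-- The node with Robin-type input `((1 - P) R Γ₀ + (1 + P) Γ₁) / 2`, interior operator `𝒜` and
output `((1 + P) R Γ₀ + (1 - P) Γ₁) / 2`. -/
def robinNode (T : S.DualPairTriplet G₁ G₂)
    (P : AntiDual (WithLp 2 (G₁ × G₂)) →L[ℂ] AntiDual (WithLp 2 (G₁ × G₂))) :
    Colligation (AntiDual (WithLp 2 (G₁ × G₂))) S.StateSpace
      (AntiDual (WithLp 2 (G₁ × G₂))) where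
  dom := S.stateDom
  G := (2⁻¹ : ℂ) • ((1 - P).toLinearMap.comp T.RΓ₀ + (1 + P).toLinearMap.comp T.Γ₁)
  L := S.stateOp.toFun
  K := (2⁻¹ : ℂ) • ((1 + P).toLinearMap.comp T.RΓ₀ + (1 - P).toLinearMap.comp T.Γ₁)

end DualPairTriplet

end SecondOrderSystem

end

/-! The state operator `𝒜`, with `a = R Γ₀` and `b = Γ₁`, forms a skew boundary triple
(`isSkewBoundaryTriple`). It is closed, it satisfies `⟨𝒜z, w⟩ + ⟨z, 𝒜w⟩ = ⟨az, bw⟩ + ⟨bz, aw⟩`, the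
pair `(a, b)` is onto, and a pair that formally belongs to the negative adjoint of `𝒜` on `ker a ∩
ker b` lies in the graph of `𝒜`. Here `A* ⊂ -B` and the closedness of `A` and `B` enter, and uniform
positivity makes the energetic space complete and embeds it continuously in `X`.

Everything else holds for an abstract triple. Green's identity polarizes to `4 Re⟨z, Lz⟩ = ‖az +
bz‖² - ‖az - bz‖²`. A boundary condition `az + bz = P(az - bz)` with a contraction `P` therefore
gives a dissipative restriction of `L`. It is maximal because a vector orthogonal to the range of `r
- L` on this restriction satisfies the adjoint boundary condition, which has the opposite sign of
energy flow (`isMaximalDissipative_mainOp`). The Lumer–Phillips theorem, proved through Yosida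
approximations, supplies the semigroup, and the closed graph theorem makes `a` and `b` continuous
for the graph norm, so that the nodes are closed.

The input of `N` vanishes when `az + bz = 0`, the condition for the contraction `0`; that of `N⁽¹⁾`
vanishes under the condition for `P`. Both nodes are thus internally well-posed. The Cayley
transform with parameter 1 exchanges them, so the impedance claims for `N⁽¹⁾` reduce to
`energy_balance` for `N`. Finally, `𝒜** = 𝒜` because `𝒜` is closed and densely defined. -/

noncomputable section

/-! ### Closed operators and double adjoints. -/

section ClosedOperators

variable {E F : Type*}
  [NormedAddCommGroup E] [InnerProductSpace ℂ E] [CompleteSpace E]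
  [NormedAddCommGroup F] [InnerProductSpace ℂ F] [CompleteSpace F]

/-- A closed subspace of `E × F` is its own double annihilator. -/
theorem Submodule.mem_prod_of_forall_inner {K : Submodule ℂ (E × F)}
    (hK : IsClosed (K : Set (E × F))) {x : E × F}
    (h : ∀ p q, (∀ a b, (a, b) ∈ K → inner ℂ a p + inner ℂ b q = 0) →
      inner ℂ x.1 p + inner ℂ x.2 q = 0) : x ∈ K := by
  -- The product carries the sup norm, so the double orthogonal complement is taken in its Hilbert
  -- space version.
  let K' : Submodule ℂ (WithLp 2 (E × F)) :=
    K.comap (WithLp.linearEquiv 2 ℂ (E × F)).toLinearMap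
  have hc : IsClosed (K' : Set (WithLp 2 (E × F))) :=
    IsClosed.preimage (WithLp.prod_continuous_ofLp 2 E F) hK
  have : CompleteSpace K' := hc.completeSpace_coe
  have hx : WithLp.toLp 2 x ∈ K'ᗮᗮ := by
    refine (Submodule.mem_orthogonal' _ _).2 fun r hr => ?_
    rw [WithLp.prod_inner_apply]
    refine h _ _ fun a b hab => ?_
    have := (Submodule.mem_orthogonal _ _).1 hr (WithLp.toLp 2 (a, b)) hab
    rwa [WithLp.prod_inner_apply] at this
  rw [Submodule.orthogonal_orthogonal] at hx
  exact hx

namespace LinearPMap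

variable {T : E →ₗ.[ℂ] F}

/-- A closed densely defined operator contains the formal adjoint relation of its adjoint. -/
theorem IsClosed.mem_graph_of_adjoint (hc : T.IsClosed) (hd : Dense (T.domain : Set E))
    {x : E} {y : F} (h : ∀ v : T†.domain, inner ℂ (T† v) x = inner ℂ (v : F) y) :
    (x, y) ∈ T.graph := by
  refine Submodule.mem_prod_of_forall_inner hc fun p q hpq => ?_
  -- Annihilating the graph of `T` means exactly that `q` lies in the domain of the adjoint, with
  -- value `-p`.
  have hq : ∀ a : T.domain, inner ℂ (-p) (a : E) = inner ℂ q (T a) := by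
    intro a
    have := hpq _ _ (T.mem_graph a)
    rw [← inner_conj_symm, ← inner_conj_symm q, inner_neg_right, eq_comm,
      eq_neg_of_add_eq_zero_right this]
  have hqd : q ∈ T†.domain := mem_adjoint_domain_of_exists _ ⟨_, hq⟩
  have h1 := h ⟨q, hqd⟩
  rw [adjoint_apply_eq hd ⟨q, hqd⟩ hq] at h1
  change inner ℂ x p + inner ℂ y q = 0
  have h2 : inner ℂ p x + inner ℂ q y = 0 := by
    rw [← h1, inner_neg_left, add_neg_cancel]
  simpa using congrArg conj h2

/-- If `w` is orthogonal to the domain of the adjoint, then `(0, w)` passes the test for membership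
in the graph of `T`, and a graph contains no such pair unless `w = 0`. -/
theorem IsClosed.dense_adjoint_domain (hc : T.IsClosed) (hd : Dense (T.domain : Set E)) :
    Dense (T†.domain : Set F) := by
  rw [Submodule.dense_iff_topologicalClosure_eq_top, Submodule.topologicalClosure_eq_top_iff,
    Submodule.eq_bot_iff]
  intro w hw
  have := hc.mem_graph_of_adjoint hd (x := 0) (y := w) fun v => by
    rw [inner_zero_right, (Submodule.mem_orthogonal _ _).1 hw v v.2]
  exact T.graph_fst_eq_zero_snd this rfl

theorem IsClosed.adjoint_adjoint (hc : T.IsClosed) (hd : Dense (T.domain : Set E)) :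
    T†† = T := by
  have hd' := hc.dense_adjoint_domain hd
  apply eq_of_eq_graph
  rw [adjoint_graph_eq_graph_adjoint hd']
  ext ⟨x, y⟩
  rw [Submodule.mem_adjoint_iff]
  constructor
  · intro h
    exact hc.mem_graph_of_adjoint hd fun v => sub_eq_zero.1 (h _ _ (T†.mem_graph v))
  · rintro h a b hab
    obtain ⟨v, rfl, rfl⟩ := (mem_graph_iff _).1 hab
    obtain ⟨u, rfl, rfl⟩ := (mem_graph_iff _).1 h
    exact sub_eq_zero.2 (adjoint_isFormalAdjoint hd v u)

end LinearPMap

end ClosedOperators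

/-! ### Exponentials of bounded dissipative operators. -/

section BoundedDissipative

variable {X : Type*} [NormedAddCommGroup X] [InnerProductSpace ℂ X] [CompleteSpace X]

open NormedSpace in
theorem hasDerivAt_exp_smul_apply (C : X →L[ℂ] X) (x : X) (t : ℝ) :
    HasDerivAt (fun s : ℝ => exp (s • C) x) (exp (t • C) (C x)) t :=
  ((ContinuousLinearMap.apply ℂ X x).restrictScalars ℝ).hasFDerivAt.comp_hasDerivAt t
    (hasDerivAt_exp_smul_const (𝕂 := ℝ) C t)

open NormedSpace in
theorem hasDerivAt_exp_smul_apply' (C : X →L[ℂ] X) (x : X) (t : ℝ) :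
    HasDerivAt (fun s : ℝ => exp (s • C) x) (C (exp (t • C) x)) t :=
  ((ContinuousLinearMap.apply ℂ X x).restrictScalars ℝ).hasFDerivAt.comp_hasDerivAt t
    (hasDerivAt_exp_smul_const' (𝕂 := ℝ) C t)

/-- A bounded dissipative operator generates contractions. -/
theorem norm_exp_smul_apply_le {C : X →L[ℂ] X} (hC : ∀ x, (inner ℂ x (C x)).re ≤ 0)
    {t : ℝ} (ht : 0 ≤ t) (x : X) : ‖NormedSpace.exp (t • C) x‖ ≤ ‖x‖ := by
  let _ : InnerProductSpace ℝ X := InnerProductSpace.rclikeToReal ℂ X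
  have hd : ∀ s : ℝ, HasDerivAt (fun s : ℝ => ‖NormedSpace.exp (s • C) x‖ ^ 2)
      (2 * inner ℝ (NormedSpace.exp (s • C) x) (C (NormedSpace.exp (s • C) x))) s :=
    fun s => (hasDerivAt_exp_smul_apply' C x s).norm_sq
  have hanti : Antitone fun s : ℝ => ‖NormedSpace.exp (s • C) x‖ ^ 2 := by
    refine antitone_of_deriv_nonpos (fun s => (hd s).differentiableAt) fun s => ?_
    rw [(hd s).deriv]
    have := hC (NormedSpace.exp (s • C) x)
    have h2 : inner ℝ (NormedSpace.exp (s • C) x) (C (NormedSpace.exp (s • C) x))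
      = (inner ℂ (NormedSpace.exp (s • C) x) (C (NormedSpace.exp (s • C) x))).re := rfl
    linarith
  have := hanti ht
  simp only [zero_smul, NormedSpace.exp_zero, one_apply_eq_self] at this
  exact (pow_le_pow_iff_left₀ (norm_nonneg _) (norm_nonneg _) two_ne_zero).1 this

/-- The path `s ↦ exp(sC) exp((t-s)D) x` joins the two vectors. By commutativity its derivative is
two contractions applied to `Cx - Dx`. This makes the Yosida semigroups a Cauchy sequence. -/
theorem norm_exp_smul_apply_sub_le {C D : X →L[ℂ] X} (hC : ∀ x, (inner ℂ x (C x)).re ≤ 0)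
    (hD : ∀ x, (inner ℂ x (D x)).re ≤ 0) (hCD : Commute C D) {t : ℝ} (ht : 0 ≤ t) (x : X) :
    ‖NormedSpace.exp (t • C) x - NormedSpace.exp (t • D) x‖ ≤ t * ‖C x - D x‖ := by
  let f : ℝ → X →L[ℂ] X := fun s => NormedSpace.exp (s • C) * NormedSpace.exp ((t - s) • D)
  have hf : ∀ s : ℝ, HasDerivAt (fun s => f s x)
      (NormedSpace.exp (s • C) (NormedSpace.exp ((t - s) • D) (C x - D x))) s := by
    intro s
    have h1 := hasDerivAt_exp_smul_const (𝕂 := ℝ) C s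
    have h2 := (hasDerivAt_exp_smul_const' (𝕂 := ℝ) D (t - s)).scomp s
      ((hasDerivAt_id s).const_sub t)
    have h3 := ((ContinuousLinearMap.apply ℂ X x).restrictScalars ℝ).hasFDerivAt.comp_hasDerivAt s
      (h1.mul h2)
    refine h3.congr_deriv ?_
    have hc : Commute C (NormedSpace.exp ((t - s) • D)) := (hCD.smul_right (t - s)).exp_right
    have hc' : C (NormedSpace.exp ((t - s) • D) x) = NormedSpace.exp ((t - s) • D) (C x) :=
      congrArg (fun L : X →L[ℂ] X => L x) hc.eq
    have hd : Commute D (NormedSpace.exp ((t - s) • D)) :=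
      ((Commute.refl D).smul_right (t - s)).exp_right
    have hd' : D (NormedSpace.exp ((t - s) • D) x) = NormedSpace.exp ((t - s) • D) (D x) :=
      congrArg (fun L : X →L[ℂ] X => L x) hd.eq
    rw [sub_eq_add_neg] at hc' hd'
    simp [hc', hd', sub_eq_add_neg]
  have := norm_image_sub_le_of_norm_deriv_le_segment' (f := fun s => f s x) (a := 0) (b := t)
    (C := ‖C x - D x‖) (fun s _ => (hf s).hasDerivWithinAt) (fun s hs =>
      (norm_exp_smul_apply_le hC hs.1 _).trans
        (norm_exp_smul_apply_le hD (sub_nonneg.2 hs.2.le) _)) t (right_mem_Icc.2 ht)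
  simpa [f, mul_comm] using this

theorem norm_exp_smul_apply_sub_self_le {C : X →L[ℂ] X} (hC : ∀ x, (inner ℂ x (C x)).re ≤ 0)
    {t : ℝ} (ht : 0 ≤ t) (x : X) : ‖NormedSpace.exp (t • C) x - x‖ ≤ t * ‖C x‖ := by
  simpa using norm_exp_smul_apply_sub_le (D := 0) hC (by simp) (Commute.zero_right C) ht x

/-- First order expansion at `0` of the semigroup of a bounded operator. -/
theorem norm_exp_smul_apply_sub_sub_le (C : X →L[ℂ] X) {t M : ℝ} (ht : 0 ≤ t) (x v : X)
    (hM : ∀ s ∈ Icc 0 t, ‖NormedSpace.exp (s • C) (C x) - v‖ ≤ M) :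
    ‖NormedSpace.exp (t • C) x - x - t • v‖ ≤ t * M := by
  have := norm_image_sub_le_of_norm_deriv_le_segment'
    (f := fun s : ℝ => NormedSpace.exp (s • C) x - s • v) (a := 0) (b := t) (C := M)
    (fun s _ => ((hasDerivAt_exp_smul_apply C x s).sub
      ((hasDerivAt_id s).smul_const v)).hasDerivWithinAt)
    (fun s hs => by simpa using hM s ⟨hs.1, hs.2.le⟩) t (right_mem_Icc.2 ht)
  simpa [mul_comm, sub_right_comm] using this

end BoundedDissipative

/-! ### Maximal dissipative operators and the Lumer–Phillips theorem. -/

/-- Dissipative operators `A` in a Hilbert space such that `r - A` is surjective for `r > 0`. -/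
structure LinearPMap.IsMaximalDissipative {X : Type*} [NormedAddCommGroup X]
    [InnerProductSpace ℂ X] (A : X →ₗ.[ℂ] X) : Prop where
  dissipative : ∀ x : A.domain, (inner ℂ (x : X) (A x)).re ≤ 0
  surjective : ∀ r : ℝ, 0 < r → ∀ y : X, ∃ x : A.domain, r • (x : X) - A x = y

namespace LinearPMap.IsMaximalDissipative

variable {X : Type*} [NormedAddCommGroup X] [InnerProductSpace ℂ X] {A : X →ₗ.[ℂ] X}

/-- Pair `rx - Ax` with `x`, discard the dissipative term and apply Cauchy–Schwarz. -/
theorem mul_norm_le (hA : ∀ x : A.domain, (inner ℂ (x : X) (A x)).re ≤ 0) (r : ℝ)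
    (x : A.domain) : r * ‖(x : X)‖ ≤ ‖r • (x : X) - A x‖ := by
  rcases (norm_nonneg (x : X)).eq_or_lt with h0 | h0
  · rw [← h0, mul_zero]
    exact norm_nonneg _
  have h1 : (inner ℂ (x : X) (r • (x : X) - A x)).re
      = r * ‖(x : X)‖ ^ 2 - (inner ℂ (x : X) (A x)).re := by
    rw [inner_sub_right, inner_smul_right_eq_smul, Complex.sub_re, Complex.smul_re, smul_eq_mul,
      ← inner_self_eq_norm_sq (𝕜 := ℂ)]
    rfl
  have h2 := (Complex.re_le_norm _).trans (norm_inner_le_norm (𝕜 := ℂ) (x : X) (r • (x : X) - A x))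
  have h3 := hA x
  refine le_of_mul_le_mul_left ?_ h0
  nlinarith

theorem exists_resolvent (hA : A.IsMaximalDissipative) {r : ℝ} (hr : 0 < r) :
    ∃ R : X →L[ℂ] X, (∀ y, ∃ h : R y ∈ A.domain, r • R y - A ⟨R y, h⟩ = y) ∧
      (∀ x : A.domain, R (r • (x : X) - A x) = x) ∧ ∀ y, r * ‖R y‖ ≤ ‖y‖ := by
  choose f hf using hA.surjective r hr
  have inj : ∀ x y : A.domain, r • (x : X) - A x = r • (y : X) - A y → x = y := by
    intro x y h
    have h1 := mul_norm_le hA.dissipative r (x - y)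
    rw [LinearPMap.map_sub, Submodule.coe_sub, smul_sub, sub_sub_sub_comm, h, sub_self, norm_zero]
      at h1
    have h2 : ‖(x : X) - y‖ = 0 :=
      le_antisymm (nonpos_of_mul_nonpos_right h1 hr) (norm_nonneg _)
    exact Subtype.ext (sub_eq_zero.1 (norm_eq_zero.1 h2))
  let R : X →ₗ[ℂ] X :=
    { toFun := fun y => f y
      map_add' := fun x y => congrArg Subtype.val (inj (f (x + y)) (f x + f y) (by
        rw [hf, LinearPMap.map_add, Submodule.coe_add, smul_add, add_sub_add_comm, hf, hf]))
      map_smul' := fun c x => congrArg Subtype.val (inj (f (c • x)) (c • f x) (by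
        rw [hf, LinearPMap.map_smul, Submodule.coe_smul, smul_comm, ← smul_sub, hf])) }
  have hR : ∀ y, r * ‖R y‖ ≤ ‖y‖ := fun y =>
    (mul_norm_le hA.dissipative r (f y)).trans_eq (by rw [hf])
  refine ⟨R.mkContinuous r⁻¹ fun y => ?_, fun y => ⟨(f y).2, hf y⟩, fun x => ?_, hR⟩
  · rw [← div_eq_inv_mul, le_div_iff₀ hr, mul_comm]
    exact hR y
  · exact congrArg Subtype.val (inj _ _ (hf _))

theorem one_mem_resolventSetPMap (hA : A.IsMaximalDissipative) : 1 ∈ resolventSetPMap A := by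
  obtain ⟨R, h1, h2, -⟩ := hA.exists_resolvent one_pos
  simp only [one_smul] at h1 h2
  exact ⟨R, fun x => by simpa using h1 x, fun x => by simpa using h2 x⟩

/-- Write a vector orthogonal to the domain as `x - Ax`. Testing with `x` gives `‖x‖² = ⟨x, Ax⟩`,
whose real part is nonpositive, so `x = 0`. -/
theorem dense_domain [CompleteSpace X] (hA : A.IsMaximalDissipative) :
    Dense (A.domain : Set X) := by
  rw [Submodule.dense_iff_topologicalClosure_eq_top, Submodule.topologicalClosure_eq_top_iff,
    Submodule.eq_bot_iff]
  intro w hw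
  obtain ⟨x, rfl⟩ := hA.surjective 1 one_pos w
  have h1 := (Submodule.mem_orthogonal _ _).1 hw x x.2
  have h2 := hA.dissipative x
  rw [one_smul, inner_sub_right, sub_eq_zero] at h1
  rw [← h1] at h2
  have h3 : (x : X) = 0 := (re_inner_self_nonpos (𝕜 := ℂ)).1 h2
  have h4 : x = 0 := Subtype.ext h3
  simp [h4]

/-- The Yosida approximations. -/
theorem exists_yosida [CompleteSpace X] (hA : A.IsMaximalDissipative) :
    ∃ C : ℕ → X →L[ℂ] X, (∀ n x, (inner ℂ x (C n x)).re ≤ 0) ∧ (∀ n m, Commute (C n) (C m)) ∧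
      (∀ n (x : A.domain), ‖C n x‖ ≤ ‖A x‖) ∧
      ∀ x : A.domain, Tendsto (fun n => C n x) atTop (𝓝 (A x)) := by
  let k : ℕ → ℝ := fun n => n + 1
  have hk : ∀ n, 0 < k n := fun n => by positivity
  have hk' : Tendsto (fun n => (k n)⁻¹) atTop (𝓝 0) := by
    simpa [k] using tendsto_one_div_add_atTop_nhds_zero_nat (𝕜 := ℝ)
  choose R hdom hR hle using fun n => hA.exists_resolvent (hk n)
  let J : ℕ → X →L[ℂ] X := fun n => k n • R n
  have hJ : ∀ n x, ‖J n x‖ ≤ ‖x‖ := fun n x => by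
    rw [_root_.smul_apply, norm_smul, Real.norm_of_nonneg (hk n).le]
    exact hle n x
  have hJsub : ∀ n (x : A.domain), J n x - x = R n (A x) := fun n x => by
    have := hR n x
    rw [_root_.map_sub, ContinuousLinearMap.map_smul_of_tower] at this
    rw [_root_.smul_apply, sub_eq_iff_eq_add, ← sub_eq_iff_eq_add']
    exact this
  have hRcomm : ∀ n m, Commute (R n) (R m) := by
    -- The resolvent identity: the right side is antisymmetric in `n` and `m`, so for distinct
    -- parameters the resolvents commute.
    have key : ∀ n m x, (k m - k n) • R n (R m x) = R n x - R m x := by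
      intro n m x
      obtain ⟨h, hx⟩ := hdom m x
      have h1 := hR n ⟨R m x, h⟩
      have h2 : k n • R m x - A ⟨R m x, h⟩ = x - (k m - k n) • R m x := by
        nth_rw 3 [← hx]
        module
      rw [h2, _root_.map_sub, ContinuousLinearMap.map_smul_of_tower] at h1
      rw [eq_sub_iff_add_eq, add_comm, ← eq_sub_iff_add_eq]
      exact h1.symm
    intro n m
    rcases eq_or_ne n m with rfl | hnm
    · exact Commute.refl _
    ext x
    have h1 := key n m x
    have h2 := key m n x
    have h3 : k m - k n ≠ 0 := by
      rw [sub_ne_zero]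
      simpa [k] using hnm.symm
    refine smul_right_injective X h3 ?_
    change (k m - k n) • R n (R m x) = (k m - k n) • R m (R n x)
    rw [h1, ← neg_sub (k n), neg_smul, h2, neg_sub]
  have hJd : ∀ x : A.domain, Tendsto (fun n => J n x) atTop (𝓝 (x : X)) := by
    intro x
    rw [tendsto_iff_norm_sub_tendsto_zero]
    refine squeeze_zero (fun _ => norm_nonneg _) (fun n => ?_)
      (by simpa using hk'.mul_const ‖A x‖)
    rw [hJsub, ← div_eq_inv_mul, le_div_iff₀ (hk n), mul_comm]
    exact hle n _
  -- Convergence on a dense subspace extends to all of `X` because the `J n` are contractions.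
  have hJt : ∀ x : X, Tendsto (fun n => J n x) atTop (𝓝 x) := by
    intro x
    rw [Metric.tendsto_atTop]
    intro ε hε
    obtain ⟨x', hx', hd⟩ := Metric.dense_iff.1 hA.dense_domain x (ε / 3) (by positivity)
    obtain ⟨N, hN⟩ := Metric.tendsto_atTop.1 (hJd ⟨x', hd⟩) (ε / 3) (by positivity)
    refine ⟨N, fun n hn => ?_⟩
    have h1 := hN n hn
    have h2 := hJ n (x - x')
    rw [Metric.mem_ball, dist_comm, dist_eq_norm] at hx'
    rw [_root_.map_sub] at h2
    calc dist (J n x) x ≤ dist (J n x) (J n x') + dist (J n x') x' + dist x' x :=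
          dist_triangle4 _ _ _ _
      _ < ε / 3 + ε / 3 + ε / 3 := by
          rw [dist_eq_norm (J n x), dist_comm x', dist_eq_norm x]
          gcongr
          exact h2.trans_lt hx'
      _ = ε := by ring
  -- On the domain the approximation is `J n` after `A`, hence both bounded by `‖Ax‖` and convergent
  -- to `Ax`.
  have hC : ∀ n (x : A.domain), (k n • (J n - 1)) (x : X) = J n (A x) := fun n x => by
    rw [_root_.smul_apply, _root_.sub_apply, one_apply_eq_self, hJsub]
    rfl
  refine ⟨fun n => k n • (J n - 1), fun n x => ?_, fun n m => ?_, fun n x => ?_, fun x => ?_⟩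
  · rw [_root_.smul_apply, _root_.sub_apply, one_apply_eq_self,
      inner_smul_right_eq_smul, Complex.smul_re, inner_sub_right, Complex.sub_re]
    refine mul_nonpos_of_nonneg_of_nonpos (hk n).le ?_
    have h1 := (Complex.re_le_norm _).trans (norm_inner_le_norm (𝕜 := ℂ) x (J n x))
    have h2 : (inner ℂ x x).re = ‖x‖ ^ 2 := inner_self_eq_norm_sq (𝕜 := ℂ) x
    have h3 := mul_le_mul_of_nonneg_left (hJ n x) (norm_nonneg x)
    linarith
  · refine Commute.smul_left (Commute.smul_right ?_ _) _
    exact (((((hRcomm n m).smul_left _).smul_right _).sub_left (Commute.one_left _))).sub_right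
      (Commute.one_right _)
  · simp only [hC]
    exact hJ n _
  · simp only [hC]
    exact hJt _

variable [CompleteSpace X]

/-- The contraction semigroup of a maximal dissipative operator, with its first order behaviour at
`0` on the domain of the operator. -/
theorem exists_semigroup (hA : A.IsMaximalDissipative) :
    ∃ T : ℝ≥0 → X →L[ℂ] X, IsC0Semigroup T ∧ (∀ t x, ‖T t x‖ ≤ ‖x‖) ∧
      ∀ x : A.domain, Tendsto (fun h : ℝ≥0 => ((h : ℂ)⁻¹) • (T h x - x)) (𝓝[>] 0) (𝓝 (A x)) := by
  obtain ⟨C, hC, hcomm, hle, hlim⟩ := hA.exists_yosida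
  let E : ℕ → ℝ≥0 → X →L[ℂ] X := fun n t => NormedSpace.exp ((t : ℝ) • C n)
  have hE : ∀ n t x, ‖E n t x‖ ≤ ‖x‖ := fun n t x => norm_exp_smul_apply_le (hC n) t.2 x
  have happrox : ∀ (x : X) (ε : ℝ), 0 < ε → ∃ x' : A.domain, ‖x - x'‖ < ε := by
    intro x ε hε
    obtain ⟨x', hx', hd⟩ := Metric.dense_iff.1 hA.dense_domain x ε hε
    rw [Metric.mem_ball, dist_comm, dist_eq_norm] at hx'
    exact ⟨⟨x', hd⟩, hx'⟩
  have hEsub : ∀ n t x y, ‖E n t x - E n t y‖ ≤ ‖x - y‖ := fun n t x y => by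
    rw [← _root_.map_sub]
    exact hE n t _
  have hcauchy : ∀ t x, CauchySeq fun n => E n t x := by
    intro t x
    rw [Metric.cauchySeq_iff]
    intro ε hε
    obtain ⟨x', hx'⟩ := happrox x (ε / 3) (by positivity)
    have hδ : 0 < ε / 3 / ((t : ℝ) + 1) := by positivity
    obtain ⟨N, hN⟩ := Metric.cauchySeq_iff.1 (hlim x').cauchySeq _ hδ
    refine ⟨N, fun m hm n hn => ?_⟩
    have h1 := hN m hm n hn
    rw [dist_eq_norm, lt_div_iff₀ (by positivity)] at h1
    have h2 : ‖E m t x' - E n t x'‖ ≤ t * ‖C m x' - C n x'‖ :=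
      norm_exp_smul_apply_sub_le (hC m) (hC n) (hcomm m n) t.2 _
    have h3 : dist (E m t x') (E n t x') < ε / 3 := by
      rw [dist_eq_norm]
      have := norm_nonneg (C m x' - C n x')
      nlinarith
    have h4 : dist (E m t x) (E m t x') < ε / 3 := by
      rw [dist_eq_norm]
      exact (hEsub _ _ _ _).trans_lt hx'
    have h5 : dist (E n t x') (E n t x) < ε / 3 := by
      rw [dist_comm, dist_eq_norm]
      exact (hEsub _ _ _ _).trans_lt hx'
    have := dist_triangle4 (E m t x) (E m t x') (E n t x') (E n t x)
    linarith
  choose f hf using fun t x => cauchySeq_tendsto_of_complete (hcauchy t x)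
  let T : ℝ≥0 → X →L[ℂ] X := fun t =>
    continuousLinearMapOfTendsto (fun n => E n t) (tendsto_pi_nhds.2 (hf t))
  have hT : ∀ t x, Tendsto (fun n => E n t x) atTop (𝓝 (T t x)) := hf
  have hTle : ∀ t x, ‖T t x‖ ≤ ‖x‖ := fun t x =>
    le_of_tendsto (hT t x).norm (Eventually.of_forall fun n => hE n t x)
  have hzero : T 0 = 1 := by
    ext x
    refine tendsto_nhds_unique (hT 0 x) ?_
    simp [E]
  have hadd : ∀ s t, T (s + t) = T s * T t := by
    intro s t
    ext x
    refine tendsto_nhds_unique (hT (s + t) x) ?_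
    have h1 : ∀ n, E n (s + t) x = E n s (E n t x) := by
      intro n
      let _ : NormedAlgebra ℚ (X →L[ℂ] X) := NormedAlgebra.restrictScalars ℚ ℝ _
      simp only [E, NNReal.coe_add, add_smul]
      rw [NormedSpace.exp_add_of_commute (((Commute.refl (C n)).smul_left _).smul_right _)]
      rfl
    simp only [h1]
    change Tendsto _ _ (𝓝 (T s (T t x)))
    rw [tendsto_iff_norm_sub_tendsto_zero]
    have h2 := (tendsto_iff_norm_sub_tendsto_zero.1 (hT t x)).add
      (tendsto_iff_norm_sub_tendsto_zero.1 (hT s (T t x)))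
    rw [add_zero] at h2
    refine squeeze_zero (fun _ => norm_nonneg _) (fun n => ?_) h2
    calc _ ≤ ‖E n s (E n t x) - E n s (T t x)‖ + ‖E n s (T t x) - T s (T t x)‖ :=
          norm_sub_le_norm_sub_add_norm_sub _ _ _
      _ ≤ _ := by
          gcongr
          exact hEsub _ _ _ _
  have hTsub : ∀ t (x : A.domain), ‖T t x - x‖ ≤ t * ‖A x‖ := fun t x =>
    le_of_tendsto ((hT t x).sub_const _).norm (Eventually.of_forall fun n =>
      (norm_exp_smul_apply_sub_self_le (hC n) t.2 _).trans
        (mul_le_mul_of_nonneg_left (hle n x) t.2))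
  have hcont0 : ∀ (x : X) (ε : ℝ), 0 < ε → ∃ δ : ℝ, 0 < δ ∧ ∀ t : ℝ≥0, (t : ℝ) < δ →
      ‖T t x - x‖ < ε := by
    intro x ε hε
    obtain ⟨x', hx'⟩ := happrox x (ε / 3) (by positivity)
    refine ⟨ε / 3 / (‖A x'‖ + 1), by positivity, fun t ht => ?_⟩
    rw [lt_div_iff₀ (by positivity)] at ht
    have h1 := hTsub t x'
    have h2 := hTle t (x - x')
    have h3 : T t x - x = T t (x - x') + (T t x' - x') - (x - x') := by
      rw [_root_.map_sub]
      abel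
    have h4 : (t : ℝ) * ‖A x'‖ < ε / 3 := by
      have := t.2
      nlinarith
    calc ‖T t x - x‖ ≤ ‖T t (x - x')‖ + ‖T t x' - x'‖ + ‖x - x'‖ := by
          rw [h3]
          exact (norm_sub_le _ _).trans (by gcongr; exact norm_add_le _ _)
      _ < ε := by linarith
  have hcont : ∀ x, Continuous fun t => T t x := by
    -- The contraction `T s` factors out, so continuity everywhere follows from continuity at 0.
    have key : ∀ (x : X) (s t : ℝ≥0), s ≤ t → ‖T t x - T s x‖ ≤ ‖T (t - s) x - x‖ := by
      intro x s t hst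
      have : T t x = T s (T (t - s) x) := by
        conv_lhs => rw [← add_tsub_cancel_of_le hst, hadd]
        rfl
      rw [this, ← _root_.map_sub]
      exact hTle _ _
    intro x
    rw [Metric.continuous_iff]
    intro s ε hε
    obtain ⟨δ, hδ, h⟩ := hcont0 x ε hε
    refine ⟨δ, hδ, fun t ht => ?_⟩
    rw [NNReal.dist_eq, abs_lt] at ht
    rcases le_total s t with hst | hst
    · rw [dist_eq_norm]
      refine (key x s t hst).trans_lt (h _ ?_)
      rw [NNReal.coe_sub hst]
      exact ht.2
    · rw [dist_comm, dist_eq_norm]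
      refine (key x t s hst).trans_lt (h _ ?_)
      rw [NNReal.coe_sub hst]
      linarith
  refine ⟨T, ⟨hzero, hadd, hcont⟩, hTle, fun x => ?_⟩
  rw [Metric.tendsto_nhdsWithin_nhds]
  intro ε hε
  -- `Ax` need not lie in the domain. Its orbits are controlled uniformly in `n` through a nearby
  -- `v` that does, at a cost of `ε / 4` twice; the bound on `h` keeps the remaining term below
  -- another `ε / 4`.
  obtain ⟨v, hv⟩ := happrox (A x) (ε / 4) (by positivity)
  refine ⟨ε / 4 / (‖A v‖ + 1), by positivity, fun {h} h0 hh => ?_⟩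
  have hpos : (0 : ℝ) < h := NNReal.coe_pos.2 h0
  rw [NNReal.dist_eq, NNReal.coe_zero, sub_zero, abs_of_pos hpos,
    lt_div_iff₀ (by positivity)] at hh
  have hbound : ∀ n, ‖E n h x - x - (h : ℝ) • A x‖
      ≤ h * (‖C n x - A x‖ + 2 * (ε / 4) + h * ‖A v‖) := by
    intro n
    refine norm_exp_smul_apply_sub_sub_le (C n) h.2 x (A x) fun s hs => ?_
    have hs' : ∀ w, ‖NormedSpace.exp (s • C n) w‖ ≤ ‖w‖ :=
      norm_exp_smul_apply_le (hC n) hs.1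
    have h1 : NormedSpace.exp (s • C n) (C n x) - A x
        = NormedSpace.exp (s • C n) (C n x - A x) + NormedSpace.exp (s • C n) (A x - v)
          + (NormedSpace.exp (s • C n) (v : X) - v) - (A x - v) := by
      rw [_root_.map_sub, _root_.map_sub]
      abel
    have h2 := hs' (C n x - A x)
    have h3 := hs' (A x - v)
    have h4 : ‖NormedSpace.exp (s • C n) (v : X) - v‖ ≤ h * ‖A v‖ :=
      (norm_exp_smul_apply_sub_self_le (hC n) hs.1 _).trans
        (mul_le_mul hs.2 (hle n v) (norm_nonneg _) h.2)
    have h5 := norm_sub_le (NormedSpace.exp (s • C n) (C n x - A x)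
      + NormedSpace.exp (s • C n) (A x - v) + (NormedSpace.exp (s • C n) (v : X) - v)) (A x - v)
    have h6 := norm_add₃_le (a := NormedSpace.exp (s • C n) (C n x - A x))
      (b := NormedSpace.exp (s • C n) (A x - v)) (c := NormedSpace.exp (s • C n) (v : X) - v)
    rw [h1]
    linarith
  have hlimit : ‖T h x - x - (h : ℝ) • A x‖ ≤ h * (0 + 2 * (ε / 4) + h * ‖A v‖) :=
    le_of_tendsto_of_tendsto' (((hT h x).sub_const _).sub_const _).norm
      ((((tendsto_iff_norm_sub_tendsto_zero.1 (hlim x)).add_const _).add_const _).const_mul _)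
      hbound
  have hne : (h : ℂ) ≠ 0 := by exact_mod_cast hpos.ne'
  have heq : ((h : ℂ)⁻¹) • (T h x - x) - A x = ((h : ℂ)⁻¹) • (T h x - x - (h : ℝ) • A x) := by
    rw [smul_sub _ (T h x - x), RCLike.real_smul_eq_coe_smul (K := ℂ) (h : ℝ) (A x)]
    congr 1
    exact (inv_smul_smul₀ hne _).symm
  have hnorm : ‖((h : ℂ)⁻¹)‖ = (h : ℝ)⁻¹ := by simp
  rw [dist_eq_norm, heq, norm_smul, hnorm, ← div_eq_inv_mul, div_lt_iff₀ hpos, mul_comm ε]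
  refine hlimit.trans_lt (mul_lt_mul_of_pos_left ?_ hpos)
  nlinarith

/-- The Lumer–Phillips theorem in Hilbert spaces. -/
theorem generatesC0Semigroup (hA : A.IsMaximalDissipative) : GeneratesC0Semigroup A := by
  obtain ⟨T, hT, hle, hgen⟩ := hA.exists_semigroup
  have hgraph : ∀ x y : X, (x, y) ∈ A.graph →
      Tendsto (fun h : ℝ≥0 => ((h : ℂ)⁻¹) • (T h x - x)) (𝓝[>] 0) (𝓝 y) := by
    intro x y h
    obtain ⟨u, rfl, rfl⟩ := (mem_graph_iff _).1 h
    exact hgen u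
  refine ⟨T, hT, fun x y => ⟨hgraph x y, fun h => ?_⟩⟩
  -- It remains to see that the generator does not properly extend `A`. With `u - Au = x - y`, the
  -- generator maps `x - u` to itself, and dissipativity forces `x = u`.
  obtain ⟨u, hu⟩ := hA.surjective 1 one_pos (x - y)
  rw [one_smul] at hu
  have hlim := h.sub (hgen u)
  have hdiff : y - A u = x - u := by
    rw [sub_eq_sub_iff_add_eq_add] at hu ⊢
    rw [add_comm y]
    exact hu
  -- The difference quotients of a contraction semigroup are dissipative, and this passes to the
  -- limit.
  have hdiss : (inner ℂ (x - u) (y - A u)).re ≤ 0 := by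
    have hl : Tendsto (fun h : ℝ≥0 => (inner ℂ (x - u)
        (((h : ℂ)⁻¹) • (T h x - x) - ((h : ℂ)⁻¹) • (T h u - u))).re) (𝓝[>] 0)
        (𝓝 (inner ℂ (x - u) (y - A u)).re) :=
      (Complex.continuous_re.tendsto _).comp (tendsto_const_nhds.inner hlim)
    refine le_of_tendsto hl (Eventually.of_forall fun h => ?_)
    have h1 : ((h : ℂ)⁻¹) • (T h x - x) - ((h : ℂ)⁻¹) • (T h u - u)
        = ((h : ℝ)⁻¹) • (T h (x - u) - (x - u)) := by
      rw [← smul_sub, _root_.map_sub, RCLike.real_smul_eq_coe_smul (K := ℂ), sub_sub_sub_comm]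
      simp
    rw [h1, inner_smul_right_eq_smul, Complex.smul_re, inner_sub_right, Complex.sub_re]
    refine mul_nonpos_of_nonneg_of_nonpos (inv_nonneg.2 h.2) ?_
    have h2 := (Complex.re_le_norm _).trans (norm_inner_le_norm (𝕜 := ℂ) (x - u) (T h (x - u)))
    have h3 : (inner ℂ (x - u) (x - u)).re = ‖x - (u : X)‖ ^ 2 :=
      inner_self_eq_norm_sq (𝕜 := ℂ) _
    have h4 := mul_le_mul_of_nonneg_left (hle h (x - u)) (norm_nonneg (x - (u : X)))
    linarith
  rw [hdiff] at hdiss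
  have hxu : x - (u : X) = 0 := (re_inner_self_nonpos (𝕜 := ℂ)).1 hdiss
  rw [hxu] at hdiff
  rw [sub_eq_zero.1 hxu, sub_eq_zero.1 hdiff]
  exact mem_graph A u

end LinearPMap.IsMaximalDissipative

/-! ### Abstract skew boundary triples and their dissipative restrictions. -/

namespace LinearPMap

variable {H U : Type*} [NormedAddCommGroup H] [InnerProductSpace ℂ H] [CompleteSpace H]
  [NormedAddCommGroup U] [InnerProductSpace ℂ U] [CompleteSpace U]

/-- A closed dissipative operator is maximal dissipative if its adjoint has no positive
eigenvalues. -/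
theorem IsMaximalDissipative.of_isClosed {A : H →ₗ.[ℂ] H} (hc : A.IsClosed)
    (hd : ∀ x : A.domain, (inner ℂ (x : H) (A x)).re ≤ 0)
    (ho : ∀ (r : ℝ) (w : H), 0 < r → (∀ x : A.domain, inner ℂ (r • (x : H) - A x) w = 0) → w = 0) :
    A.IsMaximalDissipative := by
  refine ⟨hd, fun r hr => ?_⟩
  let F : A.domain →ₗ[ℂ] H := (r : ℂ) • A.domain.subtype - A.toFun
  have hF : ∀ x : A.domain, F x = r • (x : H) - A x := fun x => rfl
  -- The range is closed since `r - A` is bounded below and `A` is closed; `ho` then leaves no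
  -- nonzero vector orthogonal to it.
  have hcl : _root_.IsClosed (LinearMap.range F : Set H) := by
    refine isClosed_of_closure_subset fun y hy => ?_
    obtain ⟨s, hs, hlim⟩ := mem_closure_iff_seq_limit.1 hy
    choose x hx using hs
    have hle : ∀ m n, r * ‖(x m : H) - x n‖ ≤ ‖s m - s n‖ := fun m n => by
      have := IsMaximalDissipative.mul_norm_le hd r (x m - x n)
      rw [← hF, _root_.map_sub, hx, hx] at this
      exact this
    have hcs : CauchySeq fun n => (x n : H) := by
      rw [Metric.cauchySeq_iff]
      intro ε hε
      obtain ⟨N, hN⟩ := Metric.cauchySeq_iff.1 hlim.cauchySeq (r * ε) (by positivity)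
      refine ⟨N, fun m hm n hn => ?_⟩
      have h1 := hN m hm n hn
      rw [dist_eq_norm] at h1 ⊢
      exact lt_of_mul_lt_mul_left ((hle m n).trans_lt h1) hr.le
    obtain ⟨x₀, hx₀⟩ := cauchySeq_tendsto_of_complete hcs
    have hA : Tendsto (fun n => A (x n)) atTop (𝓝 (r • x₀ - y)) := by
      have : (fun n => A (x n)) = fun n => r • (x n : H) - s n := by
        funext n
        rw [← hx, hF, sub_sub_cancel]
      rw [this]
      exact (hx₀.const_smul r).sub hlim
    have hg : (x₀, r • x₀ - y) ∈ A.graph :=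
      hc.mem_of_tendsto (hx₀.prodMk_nhds hA) (Eventually.of_forall fun n => A.mem_graph _)
    obtain ⟨u, hu1, hu2⟩ := (mem_graph_iff _).1 hg
    refine ⟨u, ?_⟩
    dsimp only at hu1 hu2
    rw [hF, hu1, hu2, sub_sub_cancel]
  have htop : LinearMap.range F = ⊤ := by
    rw [← hcl.submodule_topologicalClosure_eq, Submodule.topologicalClosure_eq_top_iff,
      Submodule.eq_bot_iff]
    exact fun w hw => ho r w hr fun x => (Submodule.mem_orthogonal _ _).1 hw _ ⟨x, rfl⟩
  exact fun y => LinearMap.range_eq_top.1 htop y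

/-- The canonical map from the graph to the domain. -/
def graphToDomain (L : H →ₗ.[ℂ] H) : L.graph →ₗ[ℂ] L.domain :=
  ((LinearMap.fst ℂ H H).comp L.graph.subtype).codRestrict L.domain
    fun p => mem_domain_of_mem_graph p.2

theorem apply_graphToDomain {H : Type*} [NormedAddCommGroup H] [InnerProductSpace ℂ H]
    (L : H →ₗ.[ℂ] H) (p : L.graph) :
    L (L.graphToDomain p) = (p : H × H).2 :=
  ((mem_graph_snd_inj' L p.2 (L.mem_graph (L.graphToDomain p)) rfl)).symm

/-- A boundary triplet `(U, a, b)` for a closed operator `L` which is the negative adjoint of its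
restriction to `ker a ∩ ker b`; the boundary form is that of an impedance energy balance. -/
structure IsSkewBoundaryTriple (L : H →ₗ.[ℂ] H) (a b : L.domain →ₗ[ℂ] U) : Prop where
  isClosed : L.IsClosed
  green : ∀ z w : L.domain, inner ℂ (L z) (w : H) + inner ℂ (z : H) (L w)
    = inner ℂ (a z) (b w) + inner ℂ (b z) (a w)
  surjective : ∀ u v : U, ∃ z, a z = u ∧ b z = v
  maximal : ∀ w v : H, (∀ z : L.domain, a z = 0 → b z = 0 →
    inner ℂ (L z) w = -inner ℂ (z : H) v) → (w, v) ∈ L.graph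

namespace IsSkewBoundaryTriple

variable {L : H →ₗ.[ℂ] H} {a b : L.domain →ₗ[ℂ] U}

theorem re_inner {H U : Type*} [NormedAddCommGroup H] [InnerProductSpace ℂ H]
    [NormedAddCommGroup U] [InnerProductSpace ℂ U] {L : H →ₗ.[ℂ] H} {a b : L.domain →ₗ[ℂ] U}
    (h : L.IsSkewBoundaryTriple a b) (z : L.domain) :
    4 * (inner ℂ (z : H) (L z)).re = ‖a z + b z‖ ^ 2 - ‖a z - b z‖ ^ 2 := by
  have h1 := congrArg Complex.re (h.green z z)
  rw [Complex.add_re, Complex.add_re, ← inner_conj_symm (L z), ← inner_conj_symm (b z),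
    Complex.conj_re, Complex.conj_re] at h1
  have h2 := @norm_add_sq ℂ _ _ _ _ (a z) (b z)
  have h3 := @norm_sub_sq ℂ _ _ _ _ (a z) (b z)
  simp only [RCLike.re_to_complex] at h2 h3
  linarith

/-- The boundary maps are continuous for the graph norm. -/
theorem continuous_graph (h : L.IsSkewBoundaryTriple a b) :
    Continuous fun p : L.graph => (a (L.graphToDomain p), b (L.graphToDomain p)) := by
  have : CompleteSpace L.graph := h.isClosed.completeSpace_coe
  refine LinearMap.continuous_of_seq_closed_graph ((a.prod b).comp L.graphToDomain) ?_
  rintro p q ⟨α, β⟩ hp hq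
  have hz : Tendsto (fun n => (L.graphToDomain (p n) : H)) atTop (𝓝 (L.graphToDomain q)) :=
    (continuous_fst.tendsto _).comp ((continuous_subtype_val.tendsto _).comp hp)
  have hLz : Tendsto (fun n => L (L.graphToDomain (p n))) atTop (𝓝 (L (L.graphToDomain q))) := by
    simp only [apply_graphToDomain]
    exact (continuous_snd.tendsto _).comp ((continuous_subtype_val.tendsto _).comp hp)
  have ha : Tendsto (fun n => a (L.graphToDomain (p n))) atTop (𝓝 α) :=
    (continuous_fst.tendsto _).comp hq
  have hb : Tendsto (fun n => b (L.graphToDomain (p n))) atTop (𝓝 β) :=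
    (continuous_snd.tendsto _).comp hq
  -- Only the left side of Green's identity is known to converge to its value at `q`. Comparing
  -- limits shows that the boundary defect annihilates all boundary values.
  have key : ∀ w, inner ℂ (α - a (L.graphToDomain q)) (b w)
      + inner ℂ (β - b (L.graphToDomain q)) (a w) = 0 := by
    intro w
    have h1 := (ha.inner (𝕜 := ℂ) (tendsto_const_nhds (x := b w))).add
      (hb.inner (𝕜 := ℂ) (tendsto_const_nhds (x := a w)))
    have h2 := (hLz.inner (𝕜 := ℂ) (tendsto_const_nhds (x := (w : H)))).add
      (hz.inner (𝕜 := ℂ) (tendsto_const_nhds (x := L w)))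
    simp only [h.green] at h2
    rw [inner_sub_left, inner_sub_left, sub_add_sub_comm, tendsto_nhds_unique h1 h2, sub_self]
  -- The two defects are assigned crosswise, so that `key` becomes a vanishing sum of squares.
  obtain ⟨w, hw1, hw2⟩ := h.surjective (β - b (L.graphToDomain q)) (α - a (L.graphToDomain q))
  have h3 := congrArg Complex.re (key w)
  have h4 : (inner ℂ (α - a (L.graphToDomain q)) (α - a (L.graphToDomain q))).re
      = ‖α - a (L.graphToDomain q)‖ ^ 2 := inner_self_eq_norm_sq (𝕜 := ℂ) _
  have h5 : (inner ℂ (β - b (L.graphToDomain q)) (β - b (L.graphToDomain q))).re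
      = ‖β - b (L.graphToDomain q)‖ ^ 2 := inner_self_eq_norm_sq (𝕜 := ℂ) _
  rw [hw1, hw2, Complex.add_re, h4, h5, Complex.zero_re] at h3
  have h6 : ‖α - a (L.graphToDomain q)‖ = 0 := by nlinarith [norm_nonneg (α - a (L.graphToDomain q))]
  have h7 : ‖β - b (L.graphToDomain q)‖ = 0 := by nlinarith [norm_nonneg (β - b (L.graphToDomain q))]
  exact Prod.ext (sub_eq_zero.1 (norm_eq_zero.1 h6)) (sub_eq_zero.1 (norm_eq_zero.1 h7))

theorem continuous_comb (h : L.IsSkewBoundaryTriple a b) {G : L.domain →ₗ[ℂ] U}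
    {M₁ M₂ : U →L[ℂ] U} (hG : ∀ z, G z = M₁ (a z) + M₂ (b z)) :
    Continuous fun p : L.graph => G (L.graphToDomain p) := by
  simp only [hG]
  exact (M₁.continuous.comp (continuous_fst.comp h.continuous_graph)).add
    (M₂.continuous.comp (continuous_snd.comp h.continuous_graph))

/-- Closedness of `L` puts the limit state in its domain. `G` and `K` are bounded combinations of
`a` and `b`, hence graph-continuous, so their limits are the right ones. -/
theorem isClosed_combined (h : L.IsSkewBoundaryTriple a b) {G K : L.domain →ₗ[ℂ] U}
    {M₁ M₂ N₁ N₂ : U →L[ℂ] U} (hG : ∀ z, G z = M₁ (a z) + M₂ (b z))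
    (hK : ∀ z, K z = N₁ (a z) + N₂ (b z)) :
    (⟨L.domain, G, L.toFun, K⟩ : Colligation U H U).combined.IsClosed := by
  refine IsSeqClosed.isClosed ?_
  rintro s ⟨x, g, l, k⟩ hs hlim
  have hs' : ∀ n, ∃ z : L.domain, s n = ((z : H), (G z, L z, K z)) := fun n => by
    obtain ⟨z, hz1, hz2⟩ := (mem_graph_iff _).1 (hs n)
    exact ⟨z, Prod.ext hz1.symm hz2.symm⟩
  choose z hz using hs'
  have h1 : Tendsto (fun n => ((z n : H), L (z n))) atTop (𝓝 (x, l)) := by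
    have : Continuous fun p : H × (U × H × U) => (p.1, p.2.2.1) := by fun_prop
    refine ((this.tendsto _).comp hlim).congr fun n => ?_
    rw [Function.comp_apply, hz]
  have hxl : (x, l) ∈ L.graph :=
    h.isClosed.mem_of_tendsto h1 (Eventually.of_forall fun n => L.mem_graph _)
  let p : ℕ → L.graph := fun n => ⟨_, L.mem_graph (z n)⟩
  let q : L.graph := ⟨_, hxl⟩
  have hpq : Tendsto p atTop (𝓝 q) := tendsto_subtype_rng.2 h1
  have h2 : Tendsto (fun n => G (z n)) atTop (𝓝 (G (L.graphToDomain q))) :=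
    ((h.continuous_comb hG).tendsto q).comp hpq
  have h3 : Tendsto (fun n => K (z n)) atTop (𝓝 (K (L.graphToDomain q))) :=
    ((h.continuous_comb hK).tendsto q).comp hpq
  have h2' : Tendsto (fun n => G (z n)) atTop (𝓝 g) := by
    have : Continuous fun p : H × (U × H × U) => p.2.1 := by fun_prop
    refine ((this.tendsto _).comp hlim).congr fun n => ?_
    rw [Function.comp_apply, hz]
  have h3' : Tendsto (fun n => K (z n)) atTop (𝓝 k) := by
    have : Continuous fun p : H × (U × H × U) => p.2.2.2 := by fun_prop
    refine ((this.tendsto _).comp hlim).congr fun n => ?_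
    rw [Function.comp_apply, hz]
  refine (mem_graph_iff _).2 ⟨L.graphToDomain q, rfl, ?_⟩
  exact Prod.ext (tendsto_nhds_unique h2 h2')
    (Prod.ext (L.apply_graphToDomain q) (tendsto_nhds_unique h3 h3'))

/-- Boundary conditions `a z + b z = P (a z - b z)` with a contraction `P` define a maximal
dissipative restriction. -/
theorem isMaximalDissipative_mainOp (h : L.IsSkewBoundaryTriple a b) {G K : L.domain →ₗ[ℂ] U}
    {M₁ M₂ P : U →L[ℂ] U} (hG : ∀ z, G z = M₁ (a z) + M₂ (b z)) (hP : ‖P‖ ≤ 1)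
    (hker : ∀ z, G z = 0 ↔ a z + b z = P (a z - b z)) :
    (⟨L.domain, G, L.toFun, K⟩ : Colligation U H U).mainOp.IsMaximalDissipative := by
  set A := (⟨L.domain, G, L.toFun, K⟩ : Colligation U H U).mainOp
  have hdom : ∀ x : A.domain, ∃ z : L.domain, G z = 0 ∧ (z : H) = x ∧ L z = A x := by
    rintro ⟨x, ⟨z, hz, rfl⟩, hx⟩
    exact ⟨z, hz, rfl, rfl⟩
  have hdom' : ∀ z : L.domain, G z = 0 → ∃ x : A.domain, (z : H) = x ∧ L z = A x := fun z hz =>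
    ⟨⟨z, ⟨z, hz, rfl⟩, z.2⟩, rfl, rfl⟩
  have hcl : A.IsClosed := by
    -- The graph of the restriction is the kernel of a continuous map on the closed graph of `L`.
    have hset : (A.graph : Set (H × H)) =
        Subtype.val '' {p : L.graph | G (L.graphToDomain p) = 0} := by
      ext ⟨x, y⟩
      constructor
      · intro hxy
        obtain ⟨u, rfl, rfl⟩ := (mem_graph_iff _).1 hxy
        obtain ⟨z, hz, hz1, hz2⟩ := hdom u
        exact ⟨⟨_, L.mem_graph z⟩, hz, Prod.ext hz1 hz2⟩
      · rintro ⟨p, hp, hpe⟩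
        obtain ⟨u, hu1, hu2⟩ := hdom' _ hp
        rw [apply_graphToDomain, hpe] at hu2
        refine (mem_graph_iff _).2 ⟨u, hu1.symm.trans ?_, hu2.symm⟩
        exact congrArg Prod.fst hpe
    rw [LinearPMap.IsClosed, hset]
    exact h.isClosed.isClosedEmbedding_subtypeVal.isClosedMap _
      (isClosed_singleton.preimage (h.continuous_comb hG))
  refine .of_isClosed hcl (fun x => ?_) fun r w hr hw => ?_
  · obtain ⟨z, hz, hz1, hz2⟩ := hdom x
    rw [← hz1, ← hz2]
    have h1 := h.re_inner z
    have h2 := P.le_of_opNorm_le hP (a z - b z)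
    rw [← (hker z).1 hz, one_mul] at h2
    have h3 := pow_le_pow_left₀ (norm_nonneg _) h2 2
    linarith
  · have hw' : ∀ z : L.domain, G z = 0 → inner ℂ (L z) w = r • inner ℂ (z : H) w := by
      intro z hz
      obtain ⟨x, hx1, hx2⟩ := hdom' z hz
      have := hw x
      rw [← hx1, ← hx2, inner_sub_left, sub_eq_zero, inner_smul_left_eq_star_smul] at this
      simpa using this.symm
    -- States with both boundary values zero are admissible, so maximality of the triple gives `Lw =
    -- -rw`.
    have hg : (w, -(r • w)) ∈ L.graph := by
      refine h.maximal _ _ fun z haz hbz => ?_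
      rw [hw' z ((hker z).2 (by rw [haz, hbz, add_zero, sub_zero, _root_.map_zero])),
        inner_neg_right, neg_neg, inner_smul_right_eq_smul]
    obtain ⟨u, rfl, hu⟩ := (mem_graph_iff _).1 hg
    dsimp only at hu
    -- This is the adjoint boundary condition `P*(au + bu) = au - bu`. It is obtained by testing
    -- with admissible states for which `az - bz = c` is arbitrary and `az + bz = Pc`.
    have horth : ∀ c : U, inner ℂ (P c) (a u + b u) = inner ℂ c (a u - b u) := by
      intro c
      obtain ⟨z, hz1, hz2⟩ := h.surjective ((2⁻¹ : ℂ) • (P c + c)) ((2⁻¹ : ℂ) • (P c - c))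
      have hsub : a z - b z = c := by
        rw [hz1, hz2]
        module
      have hadd : a z + b z = P c := by
        rw [hz1, hz2]
        module
      have h1 := h.green z u
      rw [hw' z ((hker z).2 (by rw [hadd, hsub])), hu, inner_neg_right,
        inner_smul_right_eq_smul, add_neg_cancel] at h1
      rw [← hadd, ← hsub]
      simp only [inner_add_left, inner_add_right, inner_sub_left, inner_sub_right]
      linear_combination (-2) * h1
    have h1 : ‖a u - b u‖ ^ 2 ≤ ‖a u - b u‖ * ‖a u + b u‖ := by
      have h2 : (inner ℂ (a u - b u) (a u - b u)).re = ‖a u - b u‖ ^ 2 :=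
        inner_self_eq_norm_sq (𝕜 := ℂ) _
      rw [← h2, ← horth]
      refine ((Complex.re_le_norm _).trans (norm_inner_le_norm _ _)).trans ?_
      gcongr
      simpa using P.le_of_opNorm_le hP (a u - b u)
    have h2 : ‖a u - b u‖ ≤ ‖a u + b u‖ := by
      by_contra hcon
      push Not at hcon
      have := norm_nonneg (a u + b u)
      nlinarith
    have h3 := pow_le_pow_left₀ (norm_nonneg _) h2 2
    have h4 := h.re_inner u
    have h5 : (inner ℂ (u : H) (u : H)).re = ‖(u : H)‖ ^ 2 := inner_self_eq_norm_sq (𝕜 := ℂ) _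
    rw [hu, inner_neg_right, inner_smul_right_eq_smul, Complex.neg_re, Complex.smul_re, h5,
      smul_eq_mul] at h4
    have h6 : ‖(u : H)‖ ^ 2 ≤ 0 := by
      by_contra hcon
      push Not at hcon
      have := mul_pos hr hcon
      linarith
    exact norm_eq_zero.1 (pow_eq_zero_iff two_ne_zero |>.1 (le_antisymm h6 (sq_nonneg _)))

/-- Already the restriction to `az + bz = 0`, the case `P = 0`, is maximal dissipative and so
densely defined. -/
theorem dense_domain (h : L.IsSkewBoundaryTriple a b) : Dense (L.domain : Set H) :=
  (h.isMaximalDissipative_mainOp (G := a + b) (K := 0) (M₁ := 1) (M₂ := 1) (P := 0)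
    (fun _ => rfl) (by simp) (fun z => by simp)).dense_domain.mono fun _ hx => hx.2

theorem isInternallyWellPosed (h : L.IsSkewBoundaryTriple a b) {G K : L.domain →ₗ[ℂ] U}
    {M₁ M₂ N₁ N₂ P : U →L[ℂ] U} (hG : ∀ z, G z = M₁ (a z) + M₂ (b z))
    (hK : ∀ z, K z = N₁ (a z) + N₂ (b z)) (hsurj : ∀ w, ∃ u v, M₁ u + M₂ v = w) (hP : ‖P‖ ≤ 1)
    (hker : ∀ z, G z = 0 ↔ a z + b z = P (a z - b z)) :
    (⟨L.domain, G, L.toFun, K⟩ : Colligation U H U).IsInternallyWellPosed := by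
  have hA := h.isMaximalDissipative_mainOp (K := K) hG hP hker
  refine ⟨⟨h.isClosed_combined hG hK, fun w => ?_, ?_, ⟨1, hA.one_mem_resolventSetPMap⟩⟩,
    hA.generatesC0Semigroup⟩
  · obtain ⟨u, v, rfl⟩ := hsurj w
    obtain ⟨z, rfl, rfl⟩ := h.surjective u v
    exact ⟨z, hG z⟩
  · exact hA.dense_domain.mono fun x hx => hx.1

end IsSkewBoundaryTriple

end LinearPMap

/-! ### Energy balances of smooth solutions and the Cayley transform. -/

namespace Colligation

variable {U X Y : Type*}
  [NormedAddCommGroup U] [InnerProductSpace ℂ U] [CompleteSpace U]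
  [NormedAddCommGroup X] [InnerProductSpace ℂ X] [CompleteSpace X]
  [NormedAddCommGroup Y] [InnerProductSpace ℂ Y] [CompleteSpace Y]

theorem IsSmoothSolution.derivWithin_norm_sq {Θ : Colligation U X Y} {u : ℝ → U} {z : ℝ → Θ.dom}
    {y : ℝ → Y} (h : Θ.IsSmoothSolution u z y) {t : ℝ} (ht : t ∈ Ici (0 : ℝ)) :
    derivWithin (fun s => ‖(z s : X)‖ ^ 2) (Ici 0) t
      = 2 * (inner ℂ (z t : X) (Θ.L (z t))).re := by
  let _ : InnerProductSpace ℝ X := InnerProductSpace.rclikeToReal ℂ X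
  exact (h.state_eq t ht).norm_sq.derivWithin (uniqueDiffOn_Ici 0 t ht)

/-- Along a solution the derivative of `‖z‖²` is `2 Re⟨z, Lz⟩`, so a pointwise inequality on the
domain suffices. -/
theorem IsInternallyWellPosed.isScatteringPassive {Θ : Colligation U X Y}
    (h : Θ.IsInternallyWellPosed)
    (hd : ∀ z : Θ.dom, 2 * (inner ℂ (z : X) (Θ.L z)).re + ‖Θ.K z‖ ^ 2 ≤ ‖Θ.G z‖ ^ 2) :
    Θ.IsScatteringPassive := by
  refine ⟨h, fun u z y hs t ht => ?_⟩
  rw [hs.derivWithin_norm_sq ht, hs.input_eq t ht, hs.output_eq t ht]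
  exact hd _

theorem IsInternallyWellPosed.isScatteringEnergyPreserving {Θ : Colligation U X Y}
    (h : Θ.IsInternallyWellPosed)
    (hd : ∀ z : Θ.dom, 2 * (inner ℂ (z : X) (Θ.L z)).re + ‖Θ.K z‖ ^ 2 = ‖Θ.G z‖ ^ 2) :
    Θ.IsScatteringEnergyPreserving := by
  refine ⟨h, fun u z y hs t ht => ?_⟩
  rw [hs.derivWithin_norm_sq ht, hs.input_eq t ht, hs.output_eq t ht]
  exact hd _

end Colligation

theorem inv_sqrt_two_mul_self : ((Real.sqrt 2 : ℂ)⁻¹) * ((Real.sqrt 2 : ℂ)⁻¹) = 2⁻¹ := by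
  rw [← mul_inv, ← Complex.ofReal_mul, Real.mul_self_sqrt zero_le_two, Complex.ofReal_ofNat]

theorem inv_two_smul_add_eq_zero_iff {U : Type*} [AddCommGroup U] [Module ℂ U]
    [TopologicalSpace U] (P : U →L[ℂ] U) (u v : U) :
    (2⁻¹ : ℂ) • ((u - P u) + (v + P v)) = 0 ↔ u + v = P (u - v) := by
  rw [smul_eq_zero_iff_right (by norm_num), map_sub, ← sub_eq_zero (a := u + v)]
  refine Eq.congr_left ?_
  abel

namespace Colligation

variable {U X : Type*}
  [NormedAddCommGroup U] [InnerProductSpace ℂ U] [CompleteSpace U]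
  [NormedAddCommGroup X] [InnerProductSpace ℂ X] [CompleteSpace X]

theorem cayley_one_eq {D : Submodule ℂ X} {G G' K K' : D →ₗ[ℂ] U} {L : D →ₗ[ℂ] X}
    (hG : ∀ z, ((Real.sqrt 2 : ℂ)⁻¹) • (G z + K z) = G' z)
    (hK : ∀ z, ((Real.sqrt 2 : ℂ)⁻¹) • (G z - K z) = K' z) :
    (⟨D, G, L, K⟩ : Colligation U X U).cayley 1 = ⟨D, G', L, K'⟩ := by
  rw [← LinearMap.ext (f := ((Real.sqrt 2 : ℂ)⁻¹) • (G + K)) hG,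
    ← LinearMap.ext (f := ((Real.sqrt 2 : ℂ)⁻¹) • (G - K)) hK]
  simp [cayley]

end Colligation

/-! ### Inner products and product decompositions in anti-duals. -/

section AntiDual

variable {H : Type*} [NormedAddCommGroup H] [InnerProductSpace ℂ H] [CompleteSpace H]

theorem AntiDual.inner_riesz_left (g : H) (f : AntiDual H) : inner ℂ (riesz H g) f = f g := by
  change inner ℂ ((riesz H).symm (riesz H g)) ((riesz H).symm f) = f g
  rw [LinearIsometryEquiv.symm_apply_apply, ← riesz_apply, LinearIsometryEquiv.apply_symm_apply]

theorem antiDualProd_surjective {G₁ G₂ : Type*} [NormedAddCommGroup G₁] [InnerProductSpace ℂ G₁]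
    [NormedAddCommGroup G₂] [InnerProductSpace ℂ G₂] (v : AntiDual (WithLp 2 (G₁ × G₂))) :
    ∃ f₁ f₂, antiDualProd G₁ G₂ (f₁, f₂) = v := by
  let e := ((WithLp.prodContinuousLinearEquiv 2 ℂ G₁ G₂).symm : G₁ × G₂ →L[ℂ] WithLp 2 (G₁ × G₂))
  refine ⟨v.comp (e.comp (ContinuousLinearMap.inl ℂ G₁ G₂)),
    v.comp (e.comp (ContinuousLinearMap.inr ℂ G₁ G₂)), ?_⟩
  ext ⟨g₁, g₂⟩
  change v (e (g₁, 0)) + v (e (0, g₂)) = v (e (g₁, g₂))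
  rw [← map_add, ← map_add, Prod.mk_add_mk, add_zero, zero_add]

end AntiDual

/-! ### The energetic space and the closedness of the state operator. -/

namespace SecondOrderSystem

variable {X Y G₁ G₂ : Type*}
  [NormedAddCommGroup X] [InnerProductSpace ℂ X] [CompleteSpace X]
  [NormedAddCommGroup Y] [InnerProductSpace ℂ Y] [CompleteSpace Y]
  [NormedAddCommGroup G₁] [InnerProductSpace ℂ G₁] [CompleteSpace G₁]
  [NormedAddCommGroup G₂] [InnerProductSpace ℂ G₂] [CompleteSpace G₂]

/-- `A` as a bounded operator on the energetic space. -/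
def AEL (S : SecondOrderSystem X Y) : S.EnergySpace →L[ℂ] Y :=
  ⟨S.AE, S.AE_isometry.continuous⟩

/-- The embedding of the energetic space into `X`. -/
def embed (S : SecondOrderSystem X Y) : S.EnergySpace →L[ℂ] X where
  toLinearMap := S.A.domain.subtype.comp S.toDom.toLinearMap
  cont := by
    obtain ⟨c, hc, h⟩ := S.A_bounded_below
    refine AddMonoidHomClass.continuous_of_bound
      (S.A.domain.subtype.comp S.toDom.toLinearMap) (Real.sqrt c⁻¹) fun x => ?_
    have h1 : c * ‖(S.toDom x : X)‖ ^ 2 ≤ ‖x‖ ^ 2 := h (S.toDom x)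
    refine Real.le_sqrt_of_sq_le ?_ |>.trans_eq (b := Real.sqrt (c⁻¹ * ‖x‖ ^ 2)) ?_
    · rw [← div_eq_inv_mul, le_div_iff₀ hc, mul_comm]
      exact h1
    · rw [Real.sqrt_mul (inv_nonneg.2 hc.le), Real.sqrt_sq (norm_nonneg x)]

theorem inner_energy (S : SecondOrderSystem X Y) (x y : S.EnergySpace) :
    inner ℂ x y = inner ℂ (S.AE x) (S.AE y) := rfl

/-- Surjectivity of `A* A`, in weak form. -/
theorem exists_inner_eq (S : SecondOrderSystem X Y) (f : X) :
    ∃ x : S.EnergySpace, ∀ v : S.EnergySpace, inner ℂ f (S.embed v) = inner ℂ (S.AE x) (S.AE v) :=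
  -- The Riesz representation of `⟨f, ·⟩` in the energetic space, which is available since the
  -- embedding into `X` is bounded.
  ⟨S.embed.adjoint f, fun v => by
    rw [← inner_energy, ContinuousLinearMap.adjoint_inner_left]⟩

/-- A vector in the domain of `A*` belongs to the domain of `B`, and `B = -A*` there. -/
theorem exists_B_eq_neg (S : SecondOrderSystem X Y) {k : Y} {f : X}
    (h : ∀ x : S.A.domain, inner ℂ f (x : X) = inner ℂ k (S.A x)) :
    ∃ y : S.B.domain, (y : Y) = k ∧ S.B y = -f := by
  have hk : k ∈ (S.A)†.domain := LinearPMap.mem_adjoint_domain_of_exists _ ⟨f, h⟩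
  have h1 : (S.A)† ⟨k, hk⟩ = f := LinearPMap.adjoint_apply_eq S.A_dense _ h
  have hkB : k ∈ S.B.domain := S.adjoint_le.1 hk
  have h2 : (S.A)† ⟨k, hk⟩ = -S.B ⟨k, hkB⟩ := S.adjoint_le.2 (y := ⟨k, hkB⟩) rfl
  exact ⟨⟨k, hkB⟩, rfl, by rw [← h1, h2, neg_neg]⟩

/-- Since `-B` extends `A*`, testing against `B` includes testing against `A*`, and the closed
operator `A` contains every pair that passes the latter test. -/
theorem mem_graph_A_of_B (S : SecondOrderSystem X Y) {q : X} {p : Y}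
    (h : ∀ y : S.B.domain, inner ℂ (y : Y) p + inner ℂ (S.B y) q = 0) : (q, p) ∈ S.A.graph := by
  refine S.A_closed.mem_graph_of_adjoint S.A_dense fun k => ?_
  obtain ⟨y, hy, hBy⟩ := S.exists_B_eq_neg
    fun x => LinearPMap.adjoint_isFormalAdjoint S.A_dense k x
  have := h y
  rw [hBy, hy, inner_neg_left, ← sub_eq_add_neg, sub_eq_zero] at this
  exact this.symm

/-- The state with displacement `x` and velocity `v`. -/
def mkState (S : SecondOrderSystem X Y) (x : S.EnergySpace) (y : S.B.domain)
    (hxy : S.AE x = y) (v : S.A.domain) : S.stateDom :=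
  ⟨WithLp.toLp 2 (x, (v : X)), by
    refine ⟨?_, v.2⟩
    change S.AE x ∈ S.B.domain
    rw [hxy]
    exact y.2⟩

theorem strain_mkState (S : SecondOrderSystem X Y) (x : S.EnergySpace) (y : S.B.domain)
    (hxy : S.AE x = y) (v : S.A.domain) : S.strain (S.mkState x y hxy v) = y :=
  Subtype.ext hxy

theorem velocity_mkState (S : SecondOrderSystem X Y) (x : S.EnergySpace) (y : S.B.domain)
    (hxy : S.AE x = y) (v : S.A.domain) : S.velocity (S.mkState x y hxy v) = v := rfl

theorem coe_strain (S : SecondOrderSystem X Y) (z : S.stateDom) :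
    (S.strain z : Y) = S.AE (z : S.StateSpace).fst := rfl

theorem coe_velocity (S : SecondOrderSystem X Y) (z : S.stateDom) :
    (S.velocity z : X) = (z : S.StateSpace).snd := rfl

theorem stateOp_apply (S : SecondOrderSystem X Y) (z : S.stateDom) :
    S.stateOp.toFun z = WithLp.toLp 2 (S.toDom.symm (S.velocity z), S.B (S.strain z)) := rfl

theorem inner_stateOp_left (S : SecondOrderSystem X Y) (z : S.stateDom) (w : S.StateSpace) :
    inner ℂ (S.stateOp.toFun z) w
      = inner ℂ (S.A (S.velocity z)) (S.AE w.fst) + inner ℂ (S.B (S.strain z)) w.snd := rfl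

theorem inner_state (S : SecondOrderSystem X Y) (z : S.stateDom) (w : S.StateSpace) :
    inner ℂ (z : S.StateSpace) w
      = inner ℂ (S.strain z : Y) (S.AE w.fst) + inner ℂ (S.velocity z : X) w.snd := rfl

theorem mem_stateOp_graph (S : SecondOrderSystem X Y) {w v : S.StateSpace}
    (hB : (S.AE w.fst, v.snd) ∈ S.B.graph) (hA : w.snd = S.embed v.fst) :
    (w, v) ∈ S.stateOp.graph := by
  obtain ⟨y, hy1, hy2⟩ := (LinearPMap.mem_graph_iff _).1 hB
  dsimp only at hy1 hy2
  have hw : w ∈ S.stateDom := by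
    refine ⟨hy1 ▸ y.2, ?_⟩
    rw [hA]
    exact (S.toDom v.fst).2
  refine (LinearPMap.mem_graph_iff _).2 ⟨⟨w, hw⟩, rfl, ?_⟩
  refine (S.stateOp_apply ⟨w, hw⟩).trans ?_
  have h1 : S.velocity ⟨w, hw⟩ = S.toDom v.fst := Subtype.ext hA
  have h2 : S.strain ⟨w, hw⟩ = y := Subtype.ext hy1.symm
  rw [h1, h2, hy2, LinearEquiv.symm_apply_apply]
  rfl

/-- `A` and the embedding into `X` are bounded on the energetic space, so strains and velocities
converge along with the states. What remains is the closedness of `B`. -/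
theorem isClosed_stateOp (S : SecondOrderSystem X Y) : S.stateOp.IsClosed := by
  refine IsSeqClosed.isClosed ?_
  rintro s ⟨w, v⟩ hs hlim
  have hs' : ∀ n, ∃ z : S.stateDom, (z : S.StateSpace) = (s n).1 ∧ S.stateOp.toFun z = (s n).2 :=
    fun n => (LinearPMap.mem_graph_iff _).1 (hs n)
  choose z hz1 hz2 using hs'
  have hw : Tendsto (fun n => (z n : S.StateSpace)) atTop (𝓝 w) := by
    simp only [hz1]
    exact (continuous_fst.tendsto _).comp hlim
  have hv : Tendsto (fun n => S.stateOp.toFun (z n)) atTop (𝓝 v) := by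
    simp only [hz2]
    exact (continuous_snd.tendsto _).comp hlim
  let fst := WithLp.fstL 2 ℂ S.EnergySpace X
  let snd := WithLp.sndL 2 ℂ S.EnergySpace X
  apply S.mem_stateOp_graph
  · have h1 : Tendsto (fun n => (S.strain (z n) : Y)) atTop (𝓝 (S.AE w.fst)) :=
      ((S.AEL.comp fst).continuous.tendsto w).comp hw
    have h2 : Tendsto (fun n => S.B (S.strain (z n))) atTop (𝓝 v.snd) :=
      (snd.continuous.tendsto v).comp hv
    exact S.B_closed.mem_of_tendsto (h1.prodMk_nhds h2)
      (Eventually.of_forall fun n => S.B.mem_graph _)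
  · have h1 : Tendsto (fun n => (S.velocity (z n) : X)) atTop (𝓝 w.snd) :=
      (snd.continuous.tendsto w).comp hw
    have h2 : Tendsto (fun n => (S.velocity (z n) : X)) atTop (𝓝 (S.embed v.fst)) :=
      ((S.embed.comp fst).continuous.tendsto v).comp hv
    exact tendsto_nhds_unique h1 h2

/-! ### From the boundary triplet of the dual pair to a skew boundary triple. -/

namespace DualPairTriplet

variable {S : SecondOrderSystem X Y}

theorem exists_Lam (T : S.DualPairTriplet G₁ G₂) (g : G₁) (f : AntiDual G₂) :
    ∃ x, T.Lam₁ x = g ∧ T.Lam₂ x = f :=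
  (T.Lam_surjective (g, f)).imp fun _ hx => Prod.ext_iff.1 hx

theorem exists_Pi (T : S.DualPairTriplet G₁ G₂) (f : AntiDual G₁) (g : G₂) :
    ∃ y, T.Pi₁ y = f ∧ T.Pi₂ y = g :=
  (T.Pi_surjective (f, g)).imp fun _ hy => Prod.ext_iff.1 hy

/-- The boundary form vanishes against every value of `Λ`. Since `Λ` is onto, each component of `Π
y` can be tested separately. -/
theorem Pi_eq_zero (T : S.DualPairTriplet G₁ G₂) {y : S.B.domain}
    (h : ∀ x : S.A.domain, inner ℂ (x : X) (S.B y) + inner ℂ (S.A x) (y : Y) = 0) :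
    T.Pi₁ y = 0 ∧ T.Pi₂ y = 0 := by
  have hg : ∀ x, T.Pi₁ y (T.Lam₁ x) - conj (T.Lam₂ x (T.Pi₂ y)) = 0 := fun x => by
    rw [← T.green, ← neg_add', h, neg_zero]
  constructor
  · ext g
    obtain ⟨x, hx1, hx2⟩ := T.exists_Lam g 0
    have := hg x
    rw [hx1, hx2] at this
    simpa using this
  · obtain ⟨x, hx1, hx2⟩ := T.exists_Lam 0 (riesz G₂ (T.Pi₂ y))
    have := hg x
    rw [hx1, hx2, riesz_apply] at this
    simpa using this

theorem Lam_eq_zero (T : S.DualPairTriplet G₁ G₂) {x : S.A.domain}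
    (h : ∀ y : S.B.domain, inner ℂ (x : X) (S.B y) + inner ℂ (S.A x) (y : Y) = 0) :
    T.Lam₁ x = 0 ∧ T.Lam₂ x = 0 := by
  have hg : ∀ y, T.Pi₁ y (T.Lam₁ x) - conj (T.Lam₂ x (T.Pi₂ y)) = 0 := fun y => by
    rw [← T.green, ← neg_add', h, neg_zero]
  constructor
  · obtain ⟨y, hy1, hy2⟩ := T.exists_Pi (riesz G₁ (T.Lam₁ x)) 0
    have := hg y
    rw [hy1, hy2, riesz_apply] at this
    simpa using this
  · ext g
    obtain ⟨y, hy1, hy2⟩ := T.exists_Pi 0 g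
    have := hg y
    rw [hy1, hy2] at this
    simpa using this

/-- The boundary maps `Π` vanish on `dom A*`. -/
theorem exists_B_eq_neg (T : S.DualPairTriplet G₁ G₂) {k : Y} {f : X}
    (h : ∀ x : S.A.domain, inner ℂ f (x : X) = inner ℂ k (S.A x)) :
    ∃ y : S.B.domain, (y : Y) = k ∧ S.B y = -f ∧ T.Pi₁ y = 0 ∧ T.Pi₂ y = 0 := by
  obtain ⟨y, rfl, hBy⟩ := S.exists_B_eq_neg h
  refine ⟨y, rfl, hBy, T.Pi_eq_zero fun x => ?_⟩
  rw [hBy, inner_neg_right, ← inner_conj_symm, h, inner_conj_symm, neg_add_cancel]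

/-- The boundary maps `Π` stay surjective on `dom B ∩ ran A`. -/
theorem exists_strain (T : S.DualPairTriplet G₁ G₂) (f : AntiDual G₁) (g : G₂) :
    ∃ (x : S.EnergySpace) (y : S.B.domain), S.AE x = y ∧ T.Pi₁ y = f ∧ T.Pi₂ y = g := by
  obtain ⟨y, hy1, hy2⟩ := T.exists_Pi f g
  -- `Ax` is the orthogonal projection of `y` onto `ran A`. The remainder lies in `ker A*`, where
  -- `Π` vanishes, so removing it leaves the boundary values unchanged.
  let x : S.EnergySpace := S.AEL.adjoint y
  have hx : ∀ v : S.A.domain, inner ℂ (0 : X) (v : X) = inner ℂ ((y : Y) - S.AE x) (S.A v) := by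
    intro v
    have h1 : inner ℂ x (S.toDom.symm v) = inner ℂ (y : Y) (S.AEL (S.toDom.symm v)) :=
      ContinuousLinearMap.adjoint_inner_left _ _ _
    have h2 : inner ℂ (S.AE x) (S.A v) = inner ℂ (y : Y) (S.A v) := h1
    rw [inner_zero_left, inner_sub_left, h2, sub_self]
  obtain ⟨k, hk, -, hk1, hk2⟩ := T.exists_B_eq_neg hx
  refine ⟨x, y - k, ?_, ?_, ?_⟩
  · rw [Submodule.coe_sub, hk, sub_sub_cancel]
  · rw [map_sub, hy1, hk1, sub_zero]
  · rw [map_sub, hy2, hk2, sub_zero]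

theorem RΓ₀_apply (T : S.DualPairTriplet G₁ G₂) (z : S.stateDom) :
    T.RΓ₀ z = riesz _ (WithLp.toLp 2 (T.Lam₁ (S.velocity z), T.Pi₂ (S.strain z))) := rfl

theorem Γ₁_apply (T : S.DualPairTriplet G₁ G₂) (z : S.stateDom) (g₁ : G₁) (g₂ : G₂) :
    T.Γ₁ z (WithLp.toLp 2 (g₁, g₂)) = -T.Pi₁ (S.strain z) g₁ + T.Lam₂ (S.velocity z) g₂ := rfl

theorem Γ₁_eq_zero (T : S.DualPairTriplet G₁ G₂) {z : S.stateDom}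
    (h1 : T.Pi₁ (S.strain z) = 0) (h2 : T.Lam₂ (S.velocity z) = 0) : T.Γ₁ z = 0 := by
  ext ⟨g₁, g₂⟩
  simp [Γ₁_apply, h1, h2]

theorem RΓ₀_eq_zero (T : S.DualPairTriplet G₁ G₂) {z : S.stateDom}
    (h1 : T.Lam₁ (S.velocity z) = 0) (h2 : T.Pi₂ (S.strain z) = 0) : T.RΓ₀ z = 0 := by
  rw [RΓ₀_apply, h1, h2]
  exact map_zero _

/-- Green's identity for the strain of `w` with the velocity of `z`, added to the conjugate of the
same identity with `z` and `w` exchanged. -/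
theorem green_stateOp (T : S.DualPairTriplet G₁ G₂) (z w : S.stateDom) :
    inner ℂ (S.stateOp.toFun z) (w : S.StateSpace)
        + inner ℂ (z : S.StateSpace) (S.stateOp.toFun w)
      = inner ℂ (T.RΓ₀ z) (T.Γ₁ w) + inner ℂ (T.Γ₁ z) (T.RΓ₀ w) := by
  rw [← inner_conj_symm (T.Γ₁ z), RΓ₀_apply, RΓ₀_apply, AntiDual.inner_riesz_left,
    AntiDual.inner_riesz_left, Γ₁_apply, Γ₁_apply, inner_stateOp_left,
    ← inner_conj_symm (z : S.StateSpace), inner_stateOp_left]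
  have h1 := T.green (S.strain w) (S.velocity z)
  have h2 := congrArg conj (T.green (S.strain z) (S.velocity w))
  simp only [map_sub, map_neg, map_add, inner_conj_symm, Complex.conj_conj] at h1 h2 ⊢
  simp only [coe_strain, coe_velocity] at h1 h2
  linear_combination -h1 - h2

theorem exists_boundary_eq (T : S.DualPairTriplet G₁ G₂) (u v : AntiDual (WithLp 2 (G₁ × G₂))) :
    ∃ z, T.RΓ₀ z = u ∧ T.Γ₁ z = v := by
  obtain ⟨⟨g₁, g₂⟩, rfl⟩ := (riesz (WithLp 2 (G₁ × G₂))).surjective u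
  obtain ⟨f₁, f₂, rfl⟩ := antiDualProd_surjective v
  obtain ⟨x, hx1, hx2⟩ := T.exists_Lam g₁ f₂
  -- Strain and velocity are chosen independently; the sign undoes the one in `Γ₁`.
  obtain ⟨e, y, hey, hy1, hy2⟩ := T.exists_strain (-f₁) g₂
  refine ⟨S.mkState e y hey x, ?_, ?_⟩
  · rw [RΓ₀_apply, velocity_mkState, strain_mkState, hx1, hy2]
  · ext ⟨k₁, k₂⟩
    rw [Γ₁_apply, velocity_mkState, strain_mkState, hx2, hy1]
    change -(-f₁ k₁) + f₂ k₂ = f₁ k₁ + f₂ k₂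
    rw [neg_neg]

theorem isSkewBoundaryTriple (T : S.DualPairTriplet G₁ G₂) :
    S.stateOp.IsSkewBoundaryTriple T.RΓ₀ T.Γ₁ where
  isClosed := S.isClosed_stateOp
  green := T.green_stateOp
  surjective := T.exists_boundary_eq
  maximal w v h := by
    apply S.mem_stateOp_graph
    · refine Submodule.mem_prod_of_forall_inner S.B_closed fun p q hpq => ?_
      have hpq' : ∀ y : S.B.domain, inner ℂ (y : Y) p + inner ℂ (S.B y) q = 0 :=
        fun y => hpq _ _ (S.B.mem_graph y)
      obtain ⟨x, hx1, hx2⟩ := (LinearPMap.mem_graph_iff _).1 (S.mem_graph_A_of_B hpq')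
      dsimp only at hx1 hx2
      subst hx1 hx2
      have hΛ := T.Lam_eq_zero (x := x) fun y => by
        have := congrArg conj (hpq' y)
        simpa [add_comm] using this
      -- States `(0, x)` with `Λx = 0` test the pair `(A w₁, v₂)` against the whole annihilator of
      -- the graph of `B`.
      have h1 := h (S.mkState 0 0 (map_zero _) x)
        (T.RΓ₀_eq_zero hΛ.1 (by rw [strain_mkState, map_zero]))
        (T.Γ₁_eq_zero (by rw [strain_mkState, map_zero]) hΛ.2)
      have h2 : inner ℂ (S.A x) (S.AE w.fst) + inner ℂ (x : X) v.snd = 0 := by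
        rw [inner_state] at h1
        have h3 := (S.inner_stateOp_left _ _).symm.trans h1
        rw [strain_mkState, velocity_mkState, LinearPMap.map_zero] at h3
        simp at h3
        rw [h3, neg_add_cancel]
      simpa using congrArg conj h2
    -- States `(x, 0)` with `A*Ax = f` have zero boundary values. As `f` is arbitrary, they identify
    -- `w₂` with `v₁` in `X`.
    · refine ext_inner_left ℂ fun f => ?_
      obtain ⟨x, hx⟩ := S.exists_inner_eq f
      obtain ⟨y, hy, hBy, hy1, hy2⟩ := T.exists_B_eq_neg (k := S.AE x) fun v => hx (S.toDom.symm v)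
      have h1 := h (S.mkState x y hy.symm 0)
        (T.RΓ₀_eq_zero (by rw [velocity_mkState, map_zero]) (by rw [strain_mkState, hy2]))
        (T.Γ₁_eq_zero (by rw [strain_mkState, hy1]) (by rw [velocity_mkState, map_zero]))
      rw [inner_state] at h1
      have h3 := (S.inner_stateOp_left _ _).symm.trans h1
      rw [strain_mkState, velocity_mkState, LinearPMap.map_zero, hBy, hy, ← hx] at h3
      simpa using h3

/-! ### The scattering and Robin nodes. -/

theorem scatteringNode_G_apply (T : S.DualPairTriplet G₁ G₂)
    (P : AntiDual (WithLp 2 (G₁ × G₂)) →L[ℂ] AntiDual (WithLp 2 (G₁ × G₂)))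
    (z : S.stateDom) :
    (T.scatteringNode P).G z = ((Real.sqrt 2 : ℂ)⁻¹) • (T.RΓ₀ z + T.Γ₁ z) := rfl

theorem scatteringNode_K_apply (T : S.DualPairTriplet G₁ G₂)
    (P : AntiDual (WithLp 2 (G₁ × G₂)) →L[ℂ] AntiDual (WithLp 2 (G₁ × G₂)))
    (z : S.stateDom) :
    (T.scatteringNode P).K z = (-(Real.sqrt 2 : ℂ)⁻¹) • (P (T.RΓ₀ z) - P (T.Γ₁ z)) := by
  rw [← map_sub]
  rfl

theorem robinNode_G_apply (T : S.DualPairTriplet G₁ G₂)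
    (P : AntiDual (WithLp 2 (G₁ × G₂)) →L[ℂ] AntiDual (WithLp 2 (G₁ × G₂)))
    (z : S.stateDom) :
    (T.robinNode P).G z
      = (2⁻¹ : ℂ) • ((T.RΓ₀ z - P (T.RΓ₀ z)) + (T.Γ₁ z + P (T.Γ₁ z))) := rfl

theorem robinNode_K_apply (T : S.DualPairTriplet G₁ G₂)
    (P : AntiDual (WithLp 2 (G₁ × G₂)) →L[ℂ] AntiDual (WithLp 2 (G₁ × G₂)))
    (z : S.stateDom) :
    (T.robinNode P).K z
      = (2⁻¹ : ℂ) • ((T.RΓ₀ z + P (T.RΓ₀ z)) + (T.Γ₁ z - P (T.Γ₁ z))) := rfl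

theorem scatteringNode_cayley_one (T : S.DualPairTriplet G₁ G₂)
    (P : AntiDual (WithLp 2 (G₁ × G₂)) →L[ℂ] AntiDual (WithLp 2 (G₁ × G₂))) :
    (T.scatteringNode P).cayley 1 = T.robinNode P := by
  have hG : ∀ z : S.stateDom, ((Real.sqrt 2 : ℂ)⁻¹) •
      ((T.scatteringNode P).G z + (T.scatteringNode P).K z) = (T.robinNode P).G z := fun z => by
    rw [scatteringNode_G_apply, scatteringNode_K_apply,
      robinNode_G_apply, smul_add, smul_smul, smul_smul, mul_neg, inv_sqrt_two_mul_self]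
    module
  have hK : ∀ z : S.stateDom, ((Real.sqrt 2 : ℂ)⁻¹) •
      ((T.scatteringNode P).G z - (T.scatteringNode P).K z) = (T.robinNode P).K z := fun z => by
    rw [scatteringNode_G_apply, scatteringNode_K_apply,
      robinNode_K_apply, smul_sub, smul_smul, smul_smul, mul_neg, inv_sqrt_two_mul_self]
    module
  exact Colligation.cayley_one_eq hG hK

/-- Transforming back with the same parameter recovers `N`, which turns impedance properties of the
Robin node into scattering properties of `N`. -/
theorem robinNode_cayley_one (T : S.DualPairTriplet G₁ G₂)
    (P : AntiDual (WithLp 2 (G₁ × G₂)) →L[ℂ] AntiDual (WithLp 2 (G₁ × G₂))) :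
    (T.robinNode P).cayley 1 = T.scatteringNode P := by
  have hG : ∀ z : S.stateDom, ((Real.sqrt 2 : ℂ)⁻¹) •
      ((T.robinNode P).G z + (T.robinNode P).K z) = (T.scatteringNode P).G z := fun z => by
    rw [robinNode_G_apply, robinNode_K_apply,
      scatteringNode_G_apply]
    module
  have hK : ∀ z : S.stateDom, ((Real.sqrt 2 : ℂ)⁻¹) •
      ((T.robinNode P).G z - (T.robinNode P).K z) = (T.scatteringNode P).K z := fun z => by
    rw [robinNode_G_apply, robinNode_K_apply,
      scatteringNode_K_apply]
    module
  exact Colligation.cayley_one_eq hG hK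

theorem isInternallyWellPosed_robinNode (T : S.DualPairTriplet G₁ G₂)
    {P : AntiDual (WithLp 2 (G₁ × G₂)) →L[ℂ] AntiDual (WithLp 2 (G₁ × G₂))} (hP : ‖P‖ ≤ 1) :
    (T.robinNode P).IsInternallyWellPosed := by
  refine T.isSkewBoundaryTriple.isInternallyWellPosed (G := (T.robinNode P).G)
    (K := (T.robinNode P).K) (M₁ := (2⁻¹ : ℂ) • (1 - P)) (M₂ := (2⁻¹ : ℂ) • (1 + P))
    (N₁ := (2⁻¹ : ℂ) • (1 + P)) (N₂ := (2⁻¹ : ℂ) • (1 - P)) (P := P)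
    (fun z => ?_) (fun z => ?_) (fun w => ⟨w, w, ?_⟩) hP fun z => ?_
  · exact (T.robinNode_G_apply P z).trans (smul_add _ _ _)
  · exact (T.robinNode_K_apply P z).trans (smul_add _ _ _)
  · change (2⁻¹ : ℂ) • (w - P w) + (2⁻¹ : ℂ) • (w + P w) = w
    module
  · change (2⁻¹ : ℂ) • ((T.RΓ₀ z - P (T.RΓ₀ z)) + (T.Γ₁ z + P (T.Γ₁ z))) = 0 ↔ _
    exact inv_two_smul_add_eq_zero_iff P _ _

/-- `P` enters only the output and the main operator does not see it: the boundary condition is the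
one for the contraction `0`, whatever the norm of `P`. -/
theorem isInternallyWellPosed_scatteringNode (T : S.DualPairTriplet G₁ G₂)
    (P : AntiDual (WithLp 2 (G₁ × G₂)) →L[ℂ] AntiDual (WithLp 2 (G₁ × G₂))) :
    (T.scatteringNode P).IsInternallyWellPosed := by
  have hs : ((Real.sqrt 2 : ℂ)⁻¹) ≠ 0 := by simp
  refine T.isSkewBoundaryTriple.isInternallyWellPosed (G := (T.scatteringNode P).G)
    (K := (T.scatteringNode P).K) (M₁ := ((Real.sqrt 2 : ℂ)⁻¹) • 1)
    (M₂ := ((Real.sqrt 2 : ℂ)⁻¹) • 1)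
    (N₁ := (-(Real.sqrt 2 : ℂ)⁻¹) • P) (N₂ := ((Real.sqrt 2 : ℂ)⁻¹) • P) (P := 0)
    (fun z => ?_) (fun z => ?_)
    (fun w => ⟨((Real.sqrt 2 : ℂ)⁻¹)⁻¹ • w, 0, ?_⟩) (by simp) fun z => ?_
  · exact (T.scatteringNode_G_apply P z).trans (smul_add _ _ _)
  · refine (T.scatteringNode_K_apply P z).trans ?_
    rw [smul_sub, sub_eq_add_neg, ← neg_smul, neg_neg]
    rfl
  · rw [map_zero, add_zero]
    exact smul_inv_smul₀ hs w
  · change ((Real.sqrt 2 : ℂ)⁻¹) • (T.RΓ₀ z + T.Γ₁ z) = 0 ↔ _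
    exact smul_eq_zero_iff_right (M := AntiDual (WithLp 2 (G₁ × G₂))) hs

/-- The middle term is the energy lost in `P`. It is nonnegative for a contraction and zero for a
unitary `P`, which settles both scattering claims. -/
theorem energy_balance (T : S.DualPairTriplet G₁ G₂)
    (P : AntiDual (WithLp 2 (G₁ × G₂)) →L[ℂ] AntiDual (WithLp 2 (G₁ × G₂))) (z : S.stateDom) :
    2 * (inner ℂ (z : S.StateSpace) ((T.scatteringNode P).L z)).re
        + (‖T.RΓ₀ z - T.Γ₁ z‖ ^ 2 - ‖P (T.RΓ₀ z - T.Γ₁ z)‖ ^ 2) / 2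
        + ‖(T.scatteringNode P).K z‖ ^ 2
      = ‖(T.scatteringNode P).G z‖ ^ 2 := by
  have h1 : 4 * (inner ℂ (z : S.StateSpace) ((T.scatteringNode P).L z)).re
    = ‖T.RΓ₀ z + T.Γ₁ z‖ ^ 2 - ‖T.RΓ₀ z - T.Γ₁ z‖ ^ 2 := T.isSkewBoundaryTriple.re_inner z
  have hc : ‖((Real.sqrt 2 : ℂ)⁻¹)‖ ^ 2 = 2⁻¹ := by
    rw [norm_inv, Complex.norm_real, inv_pow, Real.norm_of_nonneg (Real.sqrt_nonneg _),
      Real.sq_sqrt zero_le_two]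
  rw [scatteringNode_G_apply, scatteringNode_K_apply, ← map_sub, norm_smul, norm_smul,
    norm_neg, mul_pow, mul_pow, hc]
  linarith

theorem isScatteringPassive_scatteringNode (T : S.DualPairTriplet G₁ G₂)
    {P : AntiDual (WithLp 2 (G₁ × G₂)) →L[ℂ] AntiDual (WithLp 2 (G₁ × G₂))} (hP : ‖P‖ ≤ 1) :
    (T.scatteringNode P).IsScatteringPassive := by
  refine (T.isInternallyWellPosed_scatteringNode P).isScatteringPassive fun z => ?_
  rw [← T.energy_balance P z]
  have h1 := pow_le_pow_left₀ (norm_nonneg _) (P.le_of_opNorm_le hP (T.RΓ₀ z - T.Γ₁ z)) 2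
  rw [one_mul] at h1
  linarith

theorem isScatteringEnergyPreserving_scatteringNode (T : S.DualPairTriplet G₁ G₂)
    {P : AntiDual (WithLp 2 (G₁ × G₂)) →L[ℂ] AntiDual (WithLp 2 (G₁ × G₂))}
    (hP : P ∈ unitary (AntiDual (WithLp 2 (G₁ × G₂)) →L[ℂ] AntiDual (WithLp 2 (G₁ × G₂)))) :
    (T.scatteringNode P).IsScatteringEnergyPreserving := by
  refine (T.isInternallyWellPosed_scatteringNode P).isScatteringEnergyPreserving fun z => ?_
  rw [← T.energy_balance P z, ContinuousLinearMap.norm_map_of_mem_unitary hP, sub_self, zero_div,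
    add_zero]

end DualPairTriplet

end SecondOrderSystem

end

theorem corollary3p8 {X Y G₁ G₂ : Type*}
    [NormedAddCommGroup X] [InnerProductSpace ℂ X] [CompleteSpace X]
    [NormedAddCommGroup Y] [InnerProductSpace ℂ Y] [CompleteSpace Y]
    [NormedAddCommGroup G₁] [InnerProductSpace ℂ G₁] [CompleteSpace G₁]
    [NormedAddCommGroup G₂] [InnerProductSpace ℂ G₂] [CompleteSpace G₂]
    (S : SecondOrderSystem X Y) (T : S.DualPairTriplet G₁ G₂)
    (P : AntiDual (WithLp 2 (G₁ × G₂)) →L[ℂ] AntiDual (WithLp 2 (G₁ × G₂))) :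
    (S.stateOp)†† = S.stateOp ∧
    (T.scatteringNode P).cayley 1 = T.robinNode P ∧
    (‖P‖ ≤ 1 →
      ((T.scatteringNode P).cayley 1).IsInternallyWellPosed ∧
      ((T.scatteringNode P).cayley 1).IsImpedancePassive) ∧
    (P ∈ unitary (AntiDual (WithLp 2 (G₁ × G₂)) →L[ℂ] AntiDual (WithLp 2 (G₁ × G₂))) →
      ((T.scatteringNode P).cayley 1).IsImpedanceEnergyPreserving) := by
  rw [T.scatteringNode_cayley_one]
  refine ⟨S.isClosed_stateOp.adjoint_adjoint T.isSkewBoundaryTriple.dense_domain, rfl,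
    fun hP => ⟨T.isInternallyWellPosed_robinNode hP, 1, one_pos, ?_⟩, fun hP => ⟨1, one_pos, ?_⟩⟩
  · rw [T.robinNode_cayley_one]
    exact T.isScatteringPassive_scatteringNode hP
  · rw [T.robinNode_cayley_one]
    exact T.isScatteringEnergyPreserving_scatteringNode hP
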